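/- Let $d\ge 1$, let $R\subset\mathbb R^d$ be a reduced root system (a finite set of non-zero vectors, stable under the orthogonal reflections $r_\alpha$ in the hyperplanes $\alpha^\perp$, $\alpha\in R$, with $R\cap\mathbb R\alpha=\{\pm\alpha\}$; not necessarily crystallographic), let $G$ be the group generated by the $r_\alpha$, let $R_+$ be a positive system in $R$, and let $\kappa:R\to[0,\infty)$ be $G$-invariant. Put $\gamma_\kappa=\sum_{\alpha\in R_+}\kappa_\alpha$ and $\lambda_\kappa=\gamma_\kappa+\frac{d-2}{2}$. For $\xi\in\mathbb R^d$ let $$D_\xi f(x)=\partial_\xi f(x)+\sum_{\alpha\in R_+}\kappa_\alpha\langle\alpha,\xi\rangle\,\frac{f(x)-f(r_\alpha x)}{\langle\alpha,x\rangle}$$ be the Dunkl operator (the quotient is extended by continuity to $\langle\alpha,x\rangle=0$), let $D_j=D_{e_j}$ for the standard basis $e_1,\dots,e_d$, and let $\Delta_\kappa=\sum_{j=1}^d D_j^2$. For $w\in\mathbb C^d$ let $x\mapsto E_\kappa(x,w)$ be the unique real analytic function on $\mathbb R^d$ with $D_jE_\kappa(\cdot,w)=w_jE_\kappa(\cdot,w)$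 for $1\le j\le d$ and $E_\kappa(0,w)=1$ (the Dunkl kernel). Let $$h_\kappa(x)=\prod_{\alpha\in R_+}|\langle\alpha,x\rangle|^{\kappa_\alpha},\qquad b_\kappa=\left(\int_{\mathbb R^d}h_\kappa^2(x)e^{-\|x\|^2/2}\,dx\right)^{-1},\qquad J_\nu(r)=\sum_{j=0}^\infty\frac{(-1)^j(r/2)^{\nu+2j}}{j!\,\Gamma(\nu+j+1)},$$ and let $d\omega$ be the surface measure on the unit sphere $S^{d-1}$ induced by Lebesgue measure. At $r=0$ the quotient $J_\nu(r)/r^\nu$ denotes its limit $\frac{1}{2^\nu\Gamma(\nu+1)}$. Let $m\ge 0$ and let $p$ be a polynomial on $\mathbb R^d$ with complex coefficients that is homogeneous of degree $m$. Then for every $y\in\mathbb R^d$ $$b_\kappa\int_{S^{d-1}}p(x)E_\kappa(x,-iy)h_\kappa^2(x)\,d\omega(x)=(-i)^m\sum_{j=0}^{\lfloor m/2\rfloor}\frac{(-1)^j}{2^j j!}\,\frac{J_{\lambda_\kappa+m-j}(\|y\|)}{\|y\|^{\lambda_\kappa+m-j}}\,(\Delta_\kappa^j p)(y).$$ In particular,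 if moreover $\Delta_\kappa p=0$, then for every $y\in\mathbb R^d$ $$b_\kappa\int_{S^{d-1}}p(x)E_\kappa(x,-iy)h_\kappa^2(x)\,d\omega(x)=\frac{J_{\lambda_\kappa+m}(\|y\|)}{\|y\|^{\lambda_\kappa+m}}\,p(-iy).$$ -/

import Mathlib

open MeasureTheory
open scoped RealInnerProductSpace

noncomputable section

namespace Dunkl

/-- Euclidean space `ℝ^d`. -/
abbrev Space (d : ℕ) : Type := EuclideanSpace ℝ (Fin d)

variable {d : ℕ}

/-- The orthogonal reflection `r_α` in the hyperplane orthogonal to `α`. -/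
abbrev refl (α : Space d) : Space d ≃ₗᵢ[ℝ] Space d :=
  (Submodule.span ℝ {α})ᗮ.reflection

/-- `R` is a reduced (not necessarily crystallographic, not necessarily spanning) root system
in `ℝ^d`. -/
structure IsReducedRootSystem (R : Finset (Space d)) : Prop where
  ne_zero : ∀ α ∈ R, α ≠ 0
  refl_mem : ∀ α ∈ R, ∀ β ∈ R, refl α β ∈ R
  reduced : ∀ α ∈ R, ∀ c : ℝ, c • α ∈ R → c = 1 ∨ c = -1

/-- `Rp` is a positive system in `R`: the roots on the positive side of a hyperplane through the
origin that contains no root. -/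
def IsPositiveSystem (R Rp : Finset (Space d)) : Prop :=
  ∃ v : Space d, (∀ α ∈ R, ⟪α, v⟫ ≠ 0) ∧ ∀ α, α ∈ Rp ↔ α ∈ R ∧ 0 < ⟪α, v⟫

/-- The reflection group `G` generated by the reflections `r_α`, `α ∈ R`. -/
def reflectionGroup (R : Finset (Space d)) : Subgroup (Space d ≃ₗᵢ[ℝ] Space d) :=
  Subgroup.closure {g | ∃ α ∈ R, g = refl α}

/-- `κ` (of which only the values on `R` matter) is a non-negative multiplicity function. -/
structure IsMultiplicity (R : Finset (Space d)) (κ : Space d → ℝ) : Prop where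
  nonneg : ∀ α ∈ R, 0 ≤ κ α
  invariant : ∀ g ∈ reflectionGroup R, ∀ α ∈ R, κ (g α) = κ α

/-- `γ_κ`, the sum of the multiplicities over the positive roots. -/
def gam (Rp : Finset (Space d)) (κ : Space d → ℝ) : ℝ := ∑ α ∈ Rp, κ α

/-- `λ_κ = γ_κ + (d - 2) / 2`. -/
def lam (Rp : Finset (Space d)) (κ : Space d → ℝ) : ℝ := gam Rp κ + ((d : ℝ) - 2) / 2

open Classical in
/-- The difference quotient `(f(x) - f(r_α x)) / ⟨α, x⟩`. On the hyperplane `⟨α, x⟩ = 0` it is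
given its limit value: since `x - r_α x = (2 ⟨α, x⟩ / ⟨α, α⟩) α`, this is
`(2 / ⟨α, α⟩) ∂_α f(x)`. -/
def diffQuot (α : Space d) (f : Space d → ℂ) (x : Space d) : ℂ :=
  if ⟪α, x⟫ = 0 then ((2 / ⟪α, α⟫ : ℝ) : ℂ) * fderiv ℝ f x α
  else (f x - f (refl α x)) / ((⟪α, x⟫ : ℝ) : ℂ)

/-- The Dunkl operator `D_ξ` on (smooth) functions. -/
def dunklOp (Rp : Finset (Space d)) (κ : Space d → ℝ) (ξ : Space d) (f : Space d → ℂ) :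
    Space d → ℂ :=
  fun x => fderiv ℝ f x ξ + ∑ α ∈ Rp, ((κ α * ⟪α, ξ⟫ : ℝ) : ℂ) * diffQuot α f x

/-- The `j`-th Dunkl operator `D_j = D_{e_j}`. -/
def dunklD (Rp : Finset (Space d)) (κ : Space d → ℝ) (j : Fin d) :
    (Space d → ℂ) → Space d → ℂ :=
  dunklOp Rp κ (EuclideanSpace.single j (1 : ℝ))

/-- The Dunkl Laplacian `Δ_κ = ∑_j D_j²`. -/
def dunklLaplacian (Rp : Finset (Space d)) (κ : Space d → ℝ) (f : Space d → ℂ) :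
    Space d → ℂ :=
  fun x => ∑ j : Fin d, dunklD Rp κ j (dunklD Rp κ j f) x

/-- The defining property of the function `x ↦ E_κ(x, w)`, for a spectral parameter
`w ∈ ℂ^d`: it is real analytic on `ℝ^d`, it satisfies `D_j f = w_j f` for all `j`, and
`f(0) = 1`. -/
structure IsDunklKernel (Rp : Finset (Space d)) (κ : Space d → ℝ) (w : Fin d → ℂ)
    (f : Space d → ℂ) : Prop where
  analytic : AnalyticOnNhd ℝ f Set.univ
  eigen : ∀ (j : Fin d) (x : Space d), dunklD Rp κ j f x = w j * f x
  map_zero : f 0 = 1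

open Classical in
/-- The Dunkl kernel `E_κ(x, w)`, for `x ∈ ℝ^d` and `w ∈ ℂ^d`: `x ↦ E_κ(x, w)` is the real
analytic function with the defining property above. For a root system and a non-negative
multiplicity function there is exactly one such function. -/
def dunklKernel (Rp : Finset (Space d)) (κ : Space d → ℝ) (x : Space d) (w : Fin d → ℂ) : ℂ :=
  if h : ∃ f, IsDunklKernel Rp κ w f then h.choose x else 0

/-- The weight function `h_κ(x) = ∏_{α ∈ R_+} |⟨α, x⟩|^{κ_α}`. -/
def weight (Rp : Finset (Space d)) (κ : Space d → ℝ) (x : Space d) : ℝ :=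
  ∏ α ∈ Rp, |⟪α, x⟫| ^ κ α

/-- The normalizing constant `b_κ`. -/
def bConst (Rp : Finset (Space d)) (κ : Space d → ℝ) : ℝ :=
  (∫ x : Space d, weight Rp κ x ^ 2 * Real.exp (-‖x‖ ^ 2 / 2))⁻¹

/-- The Bessel function of the first kind `J_ν(r)` (used for `r ≥ 0`). -/
def besselJ (ν r : ℝ) : ℝ :=
  ∑' j : ℕ, (-1) ^ j * (r / 2) ^ (ν + 2 * (j : ℝ)) / ((j.factorial : ℝ) * Real.Gamma (ν + j + 1))

open Classical in
/-- The function `J_ν(r) / r^ν`, with its limit value `1 / (2^ν Γ(ν + 1))` at `r = 0`. -/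
def besselQuot (ν r : ℝ) : ℝ :=
  if r = 0 then 1 / (2 ^ ν * Real.Gamma (ν + 1)) else besselJ ν r / r ^ ν

/-- The function on `ℝ^d` given by a polynomial with complex coefficients. -/
def polyFun (p : MvPolynomial (Fin d) ℂ) : Space d → ℂ :=
  fun x => MvPolynomial.eval (fun j => (x j : ℂ)) p

/-- The polynomial `p` is `κ`-harmonic: `Δ_κ p = 0`. -/
def IsHarmonicPoly (Rp : Finset (Space d)) (κ : Space d → ℝ) (p : MvPolynomial (Fin d) ℂ) :
    Prop :=
  ∀ x, dunklLaplacian Rp κ (polyFun p) x = 0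

/-- `-i y ∈ ℂ^d` for `y ∈ ℝ^d`. -/
def negI (y : Space d) : Fin d → ℂ := fun j => -Complex.I * (y j : ℂ)

/-- `b_κ ∫_{S^{d-1}} p(x) E_κ(x, -iy) h_κ²(x) dω(x)`, where `dω` is the surface measure on the
unit sphere induced from Lebesgue measure. -/
def sphericalTransform (Rp : Finset (Space d)) (κ : Space d → ℝ) (p : MvPolynomial (Fin d) ℂ)
    (y : Space d) : ℂ :=
  (bConst Rp κ : ℂ) * ∫ x : Metric.sphere (0 : Space d) 1,
    polyFun p x * dunklKernel Rp κ x (negI y) * ((weight Rp κ x ^ 2 : ℝ) : ℂ)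
      ∂(volume : Measure (Space d)).toSphere

end Dunkl

end

noncomputable section

namespace Dunkl

variable {d : ℕ}

section

lemma refl_apply (α x : Space d) : refl α x = x - (2 * ⟪α, x⟫ / ⟪α, α⟫) • α := by
  rw [refl, Submodule.reflection_orthogonal_apply, Submodule.reflection_singleton_apply,
    real_inner_self_eq_norm_sq]
  simp only [RCLike.ofReal_real_eq_id, id_eq]
  rw [neg_sub, two_nsmul, ← add_smul]
  congr 2
  ring

lemma refl_refl (α x : Space d) : refl α (refl α x) = x :=
  Submodule.reflection_reflection _ x

lemma inner_refl (α x y : Space d) : ⟪refl α x, y⟫ = ⟪x, refl α y⟫ := by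
  rw [← LinearIsometryEquiv.inner_map_map (refl α), refl_refl]

lemma refl_neg (α : Space d) : refl (-α) = refl α := by
  ext1 x
  simp only [refl_apply, inner_neg_left, inner_neg_right, neg_neg, smul_neg]
  rw [sub_eq_sub_iff_add_eq_add, add_right_inj, ← neg_smul]
  congr 1
  ring

lemma refl_self (α : Space d) : refl α α = -α :=
  Submodule.reflection_orthogonalComplement_singleton_eq_neg α

lemma inner_self_refl (α x : Space d) : ⟪α, refl α x⟫ = -⟪α, x⟫ := by
  rw [← inner_refl, refl_self, inner_neg_left]

lemma refl_eq_self {α x : Space d} (h : ⟪α, x⟫ = 0) : refl α x = x := by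
  simp [refl_apply, h]

lemma refl_map (g : Space d ≃ₗᵢ[ℝ] Space d) (α x : Space d) :
    refl (g α) (g x) = g (refl α x) := by
  simp only [refl_apply, LinearIsometryEquiv.inner_map_map, map_sub, map_smul]

/-! ### Sums over positive roots -/

section Roots

variable {R Rp : Finset (Space d)} {κ : Space d → ℝ}

lemma IsPositiveSystem.mem (hRp : IsPositiveSystem R Rp) {α : Space d} (h : α ∈ Rp) : α ∈ R := by
  obtain ⟨v, -, hv⟩ := hRp
  exact ((hv α).1 h).1

lemma IsReducedRootSystem.neg_mem (hR : IsReducedRootSystem R) {α : Space d} (h : α ∈ R) :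
    -α ∈ R := by
  simpa [refl_self] using hR.refl_mem α h α h

lemma IsMultiplicity.refl (hκ : IsMultiplicity R κ) {α β : Space d} (hβ : β ∈ R) (hα : α ∈ R) :
    κ (refl β α) = κ α :=
  hκ.invariant _ (Subgroup.subset_closure ⟨β, hβ, rfl⟩) α hα

lemma IsMultiplicity.neg (hκ : IsMultiplicity R κ) {α : Space d} (hα : α ∈ R) :
    κ (-α) = κ α := by
  rw [← refl_self, hκ.refl hα hα]

open Classical in
@[to_additive]
lemma prod_posRoots_refl {A : Type*} [CommMonoid A] (hR : IsReducedRootSystem R)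
    (hRp : IsPositiveSystem R Rp) {β : Space d} (hβ : β ∈ R) (Φ : Space d → A)
    (hΦ : ∀ α ∈ R, Φ (-α) = Φ α) :
    ∏ α ∈ Rp, Φ (refl β α) = ∏ α ∈ Rp, Φ α := by
  obtain ⟨v, hv0, hv⟩ := hRp
  have key : ∀ α ∈ Rp, (if refl β α ∈ Rp then refl β α else -refl β α) ∈ Rp := by
    intro α hα
    have hm := hR.refl_mem β hβ α ((hv α).1 hα).1
    split_ifs with h
    · exact h
    · rw [hv] at h ⊢
      refine ⟨hR.neg_mem hm, ?_⟩
      rw [inner_neg_left]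
      have := hv0 _ hm
      by_contra hc
      exact h ⟨hm, lt_of_le_of_ne (by linarith) this.symm⟩
  have neg_not : ∀ α ∈ Rp, -α ∉ Rp := by
    intro α hα h
    have h1 := ((hv _).1 h).2
    have h2 := ((hv _).1 hα).2
    rw [inner_neg_left] at h1
    linarith
  have inv : ∀ α ∈ Rp, (fun α => if refl β α ∈ Rp then refl β α else -refl β α)
      ((fun α => if refl β α ∈ Rp then refl β α else -refl β α) α) = α := by
    intro α hα
    by_cases h : refl β α ∈ Rp
    · simp [h, hα]
    · simp [h, neg_not α hα]
  refine Finset.prod_nbij' (fun α => if refl β α ∈ Rp then refl β α else -refl β α)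
    (fun α => if refl β α ∈ Rp then refl β α else -refl β α) key key inv inv ?_
  intro α hα
  split_ifs
  · rfl
  · exact (hΦ _ (hR.refl_mem β hβ α ((hv α).1 hα).1)).symm

end Roots

/-! ### Elementary properties of Dunkl operators -/

/-- Multiplication of a function by the linear form `⟨ζ, ·⟩`. -/
def linMul (ζ : Space d) (f : Space d → ℂ) : Space d → ℂ := fun x => ((⟪ζ, x⟫ : ℝ) : ℂ) * f x

lemma hasFDerivAt_linMul (ζ : Space d) {f : Space d → ℂ} {x : Space d}
    (hf : DifferentiableAt ℝ f x) :
    HasFDerivAt (linMul ζ f) (((⟪ζ, x⟫ : ℝ) : ℂ) • fderiv ℝ f x +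
      (f x) • (Complex.ofRealCLM.comp (innerSL ℝ ζ))) x := by
  have h : HasFDerivAt (fun x : Space d => ((⟪ζ, x⟫ : ℝ) : ℂ))
      (Complex.ofRealCLM.comp (innerSL ℝ ζ)) x :=
    (Complex.ofRealCLM.comp (innerSL ℝ ζ)).hasFDerivAt
  exact h.mul hf.hasFDerivAt

lemma fderiv_linMul (ζ ξ : Space d) {f : Space d → ℂ} {x : Space d}
    (hf : DifferentiableAt ℝ f x) :
    fderiv ℝ (linMul ζ f) x ξ =
      ((⟪ζ, x⟫ : ℝ) : ℂ) * fderiv ℝ f x ξ + ((⟪ζ, ξ⟫ : ℝ) : ℂ) * f x := by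
  rw [(hasFDerivAt_linMul ζ hf).fderiv]
  simp [mul_comm]

lemma diffQuot_linMul (α ζ : Space d) {f : Space d → ℂ} {x : Space d}
    (hf : DifferentiableAt ℝ f x) :
    diffQuot α (linMul ζ f) x = ((⟪ζ, x⟫ : ℝ) : ℂ) * diffQuot α f x +
      ((2 * ⟪ζ, α⟫ / ⟪α, α⟫ : ℝ) : ℂ) * f (refl α x) := by
  unfold diffQuot
  split_ifs with h
  · rw [fderiv_linMul _ _ hf, refl_eq_self h]
    push_cast
    ring
  · have h' : ((⟪α, x⟫ : ℝ) : ℂ) ≠ 0 := by exact_mod_cast h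
    have e : ⟪ζ, refl α x⟫ = ⟪ζ, x⟫ - 2 * ⟪α, x⟫ / ⟪α, α⟫ * ⟪ζ, α⟫ := by
      rw [refl_apply, inner_sub_right, inner_smul_right]
    simp only [linMul, e]
    rw [div_eq_iff h', add_mul, mul_assoc _ (_ / _), div_mul_cancel₀ _ h']
    push_cast
    ring

lemma diffQuot_comp (g : Space d ≃ₗᵢ[ℝ] Space d) (α : Space d) (f : Space d → ℂ) (x : Space d) :
    diffQuot α (f ∘ g) x = diffQuot (g α) f (g x) := by
  unfold diffQuot
  simp only [LinearIsometryEquiv.inner_map_map, refl_map]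
  have : fderiv ℝ (f ∘ g) x α = fderiv ℝ f (g x) (g α) := by
    have := g.toContinuousLinearEquiv.comp_right_fderiv (f := f) (x := x)
    exact congrArg (fun L => L α) this
  rw [this]
  rfl

lemma diffQuot_neg (α : Space d) (f : Space d → ℂ) (x : Space d) :
    diffQuot (-α) f x = -diffQuot α f x := by
  unfold diffQuot
  simp only [inner_neg_left, inner_neg_right, neg_neg, neg_eq_zero, map_neg, refl_neg]
  split_ifs
  · ring
  · push_cast
    rw [div_neg]

lemma inner_mul_diffQuot (α : Space d) (f : Space d → ℂ) (x : Space d) :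
    ((⟪α, x⟫ : ℝ) : ℂ) * diffQuot α f x = f x - f (refl α x) := by
  unfold diffQuot
  split_ifs with h
  · simp [h, refl_eq_self h]
  · exact mul_div_cancel₀ _ (by exact_mod_cast h)

lemma diffQuot_add (α : Space d) {f g : Space d → ℂ} {x : Space d}
    (hf : DifferentiableAt ℝ f x) (hg : DifferentiableAt ℝ g x) :
    diffQuot α (f + g) x = diffQuot α f x + diffQuot α g x := by
  unfold diffQuot
  rw [fderiv_add hf hg]
  split_ifs
  · simp [mul_add]
  · simp only [Pi.add_apply]
    ring

lemma diffQuot_smul (α : Space d) (c : ℂ) {f : Space d → ℂ} {x : Space d}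
    (hf : DifferentiableAt ℝ f x) :
    diffQuot α (c • f) x = c * diffQuot α f x := by
  unfold diffQuot
  rw [fderiv_const_smul hf]
  split_ifs
  · simp only [smul_apply, smul_eq_mul]
    ring
  · simp only [Pi.smul_apply, smul_eq_mul]
    ring

variable (Rp : Finset (Space d)) (κ : Space d → ℝ)

lemma dunklOp_add (ξ : Space d) {f g : Space d → ℂ}
    (hf : Differentiable ℝ f) (hg : Differentiable ℝ g) :
    dunklOp Rp κ ξ (f + g) = dunklOp Rp κ ξ f + dunklOp Rp κ ξ g := by
  ext x
  simp only [dunklOp, Pi.add_apply, fderiv_add (hf x) (hg x), diffQuot_add _ (hf x) (hg x),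
    add_apply, mul_add, Finset.sum_add_distrib]
  ring

lemma dunklOp_smul (ξ : Space d) (c : ℂ) {f : Space d → ℂ} (hf : Differentiable ℝ f) :
    dunklOp Rp κ ξ (c • f) = c • dunklOp Rp κ ξ f := by
  ext x
  simp only [dunklOp, Pi.smul_apply, fderiv_const_smul (hf x), diffQuot_smul _ c (hf x),
    smul_apply, smul_eq_mul, mul_add, Finset.mul_sum]
  congr 1
  exact Finset.sum_congr rfl fun _ _ => by ring

lemma dunklOp_const (ξ : Space d) (c : ℂ) : dunklOp Rp κ ξ (fun _ => c) = 0 := by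
  ext x
  simp [dunklOp, diffQuot]

lemma dunklOp_zero (ξ : Space d) : dunklOp Rp κ ξ 0 = 0 := dunklOp_const Rp κ ξ 0

lemma dunklOp_sum {ι : Type*} (s : Finset ι) (ξ : Space d) (f : ι → Space d → ℂ)
    (hf : ∀ i ∈ s, Differentiable ℝ (f i)) :
    dunklOp Rp κ ξ (∑ i ∈ s, f i) = ∑ i ∈ s, dunklOp Rp κ ξ (f i) := by
  classical
  induction s using Finset.induction_on with
  | empty => simp [dunklOp_zero]
  | insert a s ha ih =>
    rw [Finset.sum_insert ha, Finset.sum_insert ha, dunklOp_add, ih]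
    · exact fun i hi => hf i (Finset.mem_insert_of_mem hi)
    · exact hf a (Finset.mem_insert_self a s)
    · exact Differentiable.sum fun i hi => hf i (Finset.mem_insert_of_mem hi)

lemma dunklOp_add_left (ξ η : Space d) (f : Space d → ℂ) :
    dunklOp Rp κ (ξ + η) f = dunklOp Rp κ ξ f + dunklOp Rp κ η f := by
  ext x
  simp only [dunklOp, Pi.add_apply, inner_add_right, map_add, mul_add, Complex.ofReal_add, add_mul,
    Finset.sum_add_distrib]
  ring

lemma dunklOp_smul_left (c : ℝ) (ξ : Space d) (f : Space d → ℂ) :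
    dunklOp Rp κ (c • ξ) f = (c : ℂ) • dunklOp Rp κ ξ f := by
  ext x
  simp only [dunklOp, Pi.smul_apply, inner_smul_right, map_smul, Complex.real_smul, mul_add,
    Finset.mul_sum, smul_eq_mul]
  congr 1
  refine Finset.sum_congr rfl fun α _ => ?_
  push_cast
  ring

lemma dunklOp_refl_left (α ξ : Space d) (f : Space d → ℂ) :
    dunklOp Rp κ (refl α ξ) f = dunklOp Rp κ ξ f -
      ((2 * ⟪α, ξ⟫ / ⟪α, α⟫ : ℝ) : ℂ) • dunklOp Rp κ α f := by
  rw [refl_apply, sub_eq_add_neg, dunklOp_add_left, ← neg_smul, dunklOp_smul_left]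
  push_cast
  rw [neg_smul, sub_eq_add_neg]

lemma dunklOp_sum_left {ι : Type*} (s : Finset ι) (ξ : ι → Space d) (f : Space d → ℂ) :
    dunklOp Rp κ (∑ i ∈ s, ξ i) f = ∑ i ∈ s, dunklOp Rp κ (ξ i) f := by
  classical
  induction s using Finset.induction_on with
  | empty => ext x; simp [dunklOp]
  | insert a s ha ih => rw [Finset.sum_insert ha, Finset.sum_insert ha, dunklOp_add_left, ih]

lemma sum_smul_single (ξ : Space d) :
    ∑ j, ξ j • EuclideanSpace.single j (1 : ℝ) = ξ := by
  ext i
  simp [Pi.single_apply]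

lemma dunklOp_eq_sum (ξ : Space d) (f : Space d → ℂ) :
    dunklOp Rp κ ξ f = ∑ j, (ξ j : ℂ) • dunklD Rp κ j f := by
  conv_lhs => rw [← sum_smul_single ξ, dunklOp_sum_left]
  simp only [dunklOp_smul_left, dunklD]

/-- The coefficient of `f ∘ r_α` in the commutator of `D_ξ` with multiplication by `⟨ζ, ·⟩`. -/
def commCoeff (α ξ ζ : Space d) : ℝ := κ α * ⟪α, ξ⟫ * (2 * ⟪ζ, α⟫ / ⟪α, α⟫)

lemma dunklOp_linMul (ξ ζ : Space d) {f : Space d → ℂ} (hf : Differentiable ℝ f) :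
    dunklOp Rp κ ξ (linMul ζ f) = linMul ζ (dunklOp Rp κ ξ f) + ((⟪ζ, ξ⟫ : ℝ) : ℂ) • f +
      ∑ α ∈ Rp, (commCoeff κ α ξ ζ : ℂ) • (f ∘ refl α) := by
  ext x
  simp only [dunklOp, fderiv_linMul _ _ (hf x), diffQuot_linMul _ _ (hf x), Pi.add_apply,
    Finset.sum_apply, Pi.smul_apply, smul_eq_mul, Function.comp, linMul, mul_add,
    Finset.sum_add_distrib, Finset.mul_sum, commCoeff]
  have e1 : ∑ α ∈ Rp, ((κ α * ⟪α, ξ⟫ : ℝ) : ℂ) * (((⟪ζ, x⟫ : ℝ) : ℂ) * diffQuot α f x) =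
      ∑ α ∈ Rp, ((⟪ζ, x⟫ : ℝ) : ℂ) * (((κ α * ⟪α, ξ⟫ : ℝ) : ℂ) * diffQuot α f x) :=
    Finset.sum_congr rfl fun _ _ => by ring
  have e2 : ∑ α ∈ Rp, ((κ α * ⟪α, ξ⟫ : ℝ) : ℂ) *
        (((2 * ⟪ζ, α⟫ / ⟪α, α⟫ : ℝ) : ℂ) * f (refl α x)) =
      ∑ α ∈ Rp, ((κ α * ⟪α, ξ⟫ * (2 * ⟪ζ, α⟫ / ⟪α, α⟫) : ℝ) : ℂ) * f (refl α x) :=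
    Finset.sum_congr rfl fun _ _ => by push_cast; ring
  rw [e1, e2]
  ring

variable {Rp κ} {R : Finset (Space d)}

lemma dunklOp_comp_refl (hR : IsReducedRootSystem R) (hRp : IsPositiveSystem R Rp)
    (hκ : IsMultiplicity R κ) {β : Space d} (hβ : β ∈ R) (ξ : Space d) (f : Space d → ℂ) :
    dunklOp Rp κ ξ (f ∘ refl β) = dunklOp Rp κ (refl β ξ) f ∘ refl β := by
  ext x
  simp only [dunklOp, Function.comp]
  congr 1
  · have := (refl β).toContinuousLinearEquiv.comp_right_fderiv (f := f) (x := x)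
    exact congrArg (fun L => L ξ) this
  · rw [← sum_posRoots_refl hR hRp hβ
      (fun α => ((κ α * ⟪α, refl β ξ⟫ : ℝ) : ℂ) * diffQuot α f (refl β x))]
    · refine Finset.sum_congr rfl fun α hα => ?_
      rw [LinearIsometryEquiv.inner_map_map, hκ.refl hβ (hRp.mem hα)]
      congr 1
      exact diffQuot_comp (refl β) α f x
    · intro α hα
      rw [hκ.neg hα, inner_neg_left, diffQuot_neg]
      push_cast
      ring

/-! ### Homogeneous polynomial functions -/

/-- The space of complex-valued functions on `ℝ^d` that are homogeneous polynomials of a given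
degree. -/
def homPoly (d : ℕ) : ℕ → Submodule ℂ (Space d → ℂ)
  | 0 => Submodule.span ℂ {fun _ => 1}
  | n + 1 => Submodule.span ℂ {f | ∃ ζ : Space d, ∃ g ∈ homPoly d n, f = linMul ζ g}

lemma linMul_mem (ζ : Space d) {n : ℕ} {f : Space d → ℂ} (hf : f ∈ homPoly d n) :
    linMul ζ f ∈ homPoly d (n + 1) :=
  Submodule.subset_span ⟨ζ, f, hf, rfl⟩

lemma const_mem (c : ℂ) : (fun _ => c) ∈ homPoly d 0 := by
  have : (fun _ => c : Space d → ℂ) = c • fun _ => 1 := by ext; simp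
  rw [this]
  exact Submodule.smul_mem _ _ (Submodule.subset_span rfl)

lemma homPoly_succ_induction {n : ℕ} {motive : (Space d → ℂ) → Prop}
    (linMul : ∀ ζ f, f ∈ homPoly d n → motive (linMul ζ f)) (zero : motive 0)
    (add : ∀ f g, f ∈ homPoly d (n + 1) → g ∈ homPoly d (n + 1) → motive f → motive g →
      motive (f + g))
    (smul : ∀ (c : ℂ) f, f ∈ homPoly d (n + 1) → motive f → motive (c • f))
    {f : Space d → ℂ} (hf : f ∈ homPoly d (n + 1)) : motive f := by
  refine Submodule.span_induction (p := fun f _ => motive f) ?_ zero ?_ ?_ hf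
  · rintro _ ⟨ζ, g, hg, rfl⟩
    exact linMul ζ g hg
  · exact fun f g hf hg => add f g hf hg
  · exact fun c f hf => smul c f hf

lemma homPoly_induction {motive : ℕ → (Space d → ℂ) → Prop}
    (const : ∀ c, motive 0 (fun _ => c))
    (linMul : ∀ n ζ f, f ∈ homPoly d n → motive n f → motive (n + 1) (linMul ζ f))
    (zero : ∀ n, motive (n + 1) 0)
    (add : ∀ n f g, f ∈ homPoly d (n + 1) → g ∈ homPoly d (n + 1) → motive (n + 1) f →
      motive (n + 1) g → motive (n + 1) (f + g))
    (smul : ∀ n (c : ℂ) f, f ∈ homPoly d (n + 1) → motive (n + 1) f → motive (n + 1) (c • f))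
    {n : ℕ} {f : Space d → ℂ} (hf : f ∈ homPoly d n) : motive n f := by
  induction n generalizing f with
  | zero =>
    obtain ⟨c, rfl⟩ := Submodule.mem_span_singleton.1 hf
    convert! const c using 1
    ext; simp
  | succ n ih =>
    exact homPoly_succ_induction (fun ζ g hg => linMul n ζ g hg (ih hg)) (zero n) (add n) (smul n) hf

lemma contDiff_of_mem {n : ℕ} {f : Space d → ℂ} (hf : f ∈ homPoly d n) : ContDiff ℝ 1 f := by
  refine homPoly_induction (motive := fun _ f => ContDiff ℝ 1 f) ?_ ?_ ?_ ?_ ?_ hf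
  · exact fun c => contDiff_const
  · intro n ζ f _ h
    exact (Complex.ofRealCLM.comp (innerSL ℝ ζ)).contDiff.mul h
  · exact fun _ => contDiff_const
  · exact fun n f g _ _ hf hg => hf.add hg
  · exact fun n c f _ hf => contDiff_const.smul hf

lemma differentiable_of_mem {n : ℕ} {f : Space d → ℂ} (hf : f ∈ homPoly d n) :
    Differentiable ℝ f := (contDiff_of_mem hf).differentiable (by simp)

lemma continuous_of_mem {n : ℕ} {f : Space d → ℂ} (hf : f ∈ homPoly d n) :
    Continuous f := (contDiff_of_mem hf).continuous

lemma comp_refl_mem (α : Space d) {n : ℕ} {f : Space d → ℂ} (hf : f ∈ homPoly d n) :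
    f ∘ refl α ∈ homPoly d n := by
  refine homPoly_induction (motive := fun n f => f ∘ refl α ∈ homPoly d n) ?_ ?_ ?_ ?_ ?_ hf
  · exact fun c => const_mem c
  · intro n ζ f _ h
    have : linMul ζ f ∘ refl α = linMul (refl α ζ) (f ∘ refl α) := by
      ext x
      simp only [linMul, Function.comp, inner_refl]
    rw [this]
    exact linMul_mem _ h
  · exact fun n => Submodule.zero_mem _
  · exact fun n f g _ _ hf hg => Submodule.add_mem _ hf hg
  · exact fun n c f _ hf => Submodule.smul_mem _ c hf

lemma mul_mem {m n : ℕ} {f g : Space d → ℂ} (hf : f ∈ homPoly d m) (hg : g ∈ homPoly d n) :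
    (fun x => f x * g x) ∈ homPoly d (m + n) := by
  refine homPoly_induction (motive := fun m f => (fun x => f x * g x) ∈ homPoly d (m + n))
    ?_ ?_ ?_ ?_ ?_ hf
  · intro c
    rw [zero_add]
    exact Submodule.smul_mem _ c hg
  · intro m ζ f _ h
    have : (fun x => linMul ζ f x * g x) = linMul ζ (fun x => f x * g x) := by
      ext x
      simp only [linMul, mul_assoc]
    rw [this, Nat.succ_add]
    exact linMul_mem _ h
  · intro m
    convert! (homPoly d (m + 1 + n)).zero_mem using 1
    ext
    simp
  · intro m f₁ f₂ _ _ h₁ h₂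
    have : (fun x => (f₁ + f₂) x * g x) = (fun x => f₁ x * g x) + fun x => f₂ x * g x := by
      ext x
      simp [add_mul]
    rw [this]
    exact Submodule.add_mem _ h₁ h₂
  · intro m c f _ h
    have : (fun x => (c • f) x * g x) = c • fun x => f x * g x := by
      ext x
      simp [mul_assoc]
    rw [this]
    exact Submodule.smul_mem _ c h

lemma map_smul_of_mem {n : ℕ} {f : Space d → ℂ} (hf : f ∈ homPoly d n) (t : ℝ) (x : Space d) :
    f (t • x) = (t : ℂ) ^ n * f x := by
  refine homPoly_induction (motive := fun n f => f (t • x) = (t : ℂ) ^ n * f x) ?_ ?_ ?_ ?_ ?_ hf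
  · simp
  · intro n ζ f _ h
    simp only [linMul, h, inner_smul_right]
    push_cast
    ring
  · simp
  · intro n f g _ _ hf hg
    simp [hf, hg, mul_add]
  · intro n c f _ hf
    simp only [Pi.smul_apply, hf, smul_eq_mul]
    ring

lemma dunklOp_eq_zero_of_mem (ξ : Space d) {f : Space d → ℂ} (hf : f ∈ homPoly d 0) :
    dunklOp Rp κ ξ f = 0 := by
  obtain ⟨c, rfl⟩ := Submodule.mem_span_singleton.1 hf
  have : (c • fun _ => 1 : Space d → ℂ) = fun _ => c := by ext; simp
  rw [this, dunklOp_const]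

lemma dunklOp_mem (ξ : Space d) {n : ℕ} {f : Space d → ℂ} (hf : f ∈ homPoly d n) :
    dunklOp Rp κ ξ f ∈ homPoly d (n - 1) := by
  refine homPoly_induction (motive := fun n f => dunklOp Rp κ ξ f ∈ homPoly d (n - 1))
    ?_ ?_ ?_ ?_ ?_ hf
  · intro c
    rw [dunklOp_const]
    exact Submodule.zero_mem _
  · intro n ζ f hf h
    rw [dunklOp_linMul _ _ _ _ (differentiable_of_mem hf), Nat.add_sub_cancel]
    refine Submodule.add_mem _ (Submodule.add_mem _ ?_ (Submodule.smul_mem _ _ hf))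
      (Submodule.sum_mem _ fun α _ => Submodule.smul_mem _ _ (comp_refl_mem α hf))
    rcases n with _ | n
    · rw [dunklOp_eq_zero_of_mem ξ hf]
      convert! Submodule.zero_mem _ using 1
      ext x
      simp [linMul]
    · exact linMul_mem ζ h
  · intro n
    rw [dunklOp_zero]
    exact Submodule.zero_mem _
  · intro n f g hf hg h₁ h₂
    rw [dunklOp_add _ _ _ (differentiable_of_mem hf) (differentiable_of_mem hg)]
    exact Submodule.add_mem _ h₁ h₂
  · intro n c f hf h
    rw [dunklOp_smul _ _ _ _ (differentiable_of_mem hf)]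
    exact Submodule.smul_mem _ c h

lemma dunklOp_comm (hR : IsReducedRootSystem R) (hRp : IsPositiveSystem R Rp)
    (hκ : IsMultiplicity R κ) (ξ η : Space d) {n : ℕ} {f : Space d → ℂ} (hf : f ∈ homPoly d n) :
    dunklOp Rp κ ξ (dunklOp Rp κ η f) = dunklOp Rp κ η (dunklOp Rp κ ξ f) := by
  refine homPoly_induction (motive := fun n f =>
    dunklOp Rp κ ξ (dunklOp Rp κ η f) = dunklOp Rp κ η (dunklOp Rp κ ξ f)) ?_ ?_ ?_ ?_ ?_ hf
  · intro c
    simp [dunklOp_const, dunklOp_zero]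
  · intro n ζ f hf h
    have expand : ∀ ξ η : Space d, dunklOp Rp κ ξ (dunklOp Rp κ η (linMul ζ f)) =
        linMul ζ (dunklOp Rp κ ξ (dunklOp Rp κ η f)) +
        (((⟪ζ, ξ⟫ : ℝ) : ℂ) • dunklOp Rp κ η f + ((⟪ζ, η⟫ : ℝ) : ℂ) • dunklOp Rp κ ξ f) +
        (∑ α ∈ Rp, ((commCoeff κ α ξ ζ : ℂ) • (dunklOp Rp κ η f ∘ refl α) +
          (commCoeff κ α η ζ : ℂ) • (dunklOp Rp κ ξ f ∘ refl α)) -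
        ∑ α ∈ Rp, ((κ α * ⟪α, η⟫ * ⟪α, ξ⟫ * (2 * ⟪ζ, α⟫ / ⟪α, α⟫) * (2 / ⟪α, α⟫) : ℝ) : ℂ) •
          (dunklOp Rp κ α f ∘ refl α)) := by
      intro ξ η
      have hf' := differentiable_of_mem hf
      have hD := differentiable_of_mem (dunklOp_mem (Rp := Rp) (κ := κ) η hf)
      have hc : ∀ α ∈ Rp, Differentiable ℝ ((commCoeff κ α η ζ : ℂ) • (f ∘ refl α)) :=
        fun α _ => (differentiable_of_mem (comp_refl_mem α hf)).const_smul _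
      have hl : Differentiable ℝ (linMul ζ (dunklOp Rp κ η f)) :=
        fun x => (hasFDerivAt_linMul ζ (hD x)).differentiableAt
      rw [dunklOp_linMul _ _ η ζ hf', dunklOp_add _ _ _ (hl.add (hf'.const_smul _))
        (Differentiable.sum hc), dunklOp_add _ _ _ hl (hf'.const_smul _),
        dunklOp_linMul _ _ ξ ζ hD, dunklOp_smul _ _ _ _ hf', dunklOp_sum _ _ _ _ _ hc]
      have e : ∀ α ∈ Rp, dunklOp Rp κ ξ ((commCoeff κ α η ζ : ℂ) • (f ∘ refl α)) =
          (commCoeff κ α η ζ : ℂ) • (dunklOp Rp κ ξ f ∘ refl α) -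
          ((κ α * ⟪α, η⟫ * ⟪α, ξ⟫ * (2 * ⟪ζ, α⟫ / ⟪α, α⟫) * (2 / ⟪α, α⟫) : ℝ) : ℂ) •
            (dunklOp Rp κ α f ∘ refl α) := by
        intro α hα
        rw [dunklOp_smul _ _ _ _ (differentiable_of_mem (comp_refl_mem α hf)),
          dunklOp_comp_refl hR hRp hκ (hRp.mem hα), dunklOp_refl_left]
        ext x
        simp only [commCoeff, Pi.smul_apply, Pi.sub_apply, Function.comp, smul_eq_mul]
        push_cast
        ring
      rw [Finset.sum_congr rfl e, Finset.sum_sub_distrib, Finset.sum_add_distrib]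
      abel
    rw [expand ξ η, expand η ξ, h]
    congr 1
    · congr 1
      abel
    · congr 1
      · exact Finset.sum_congr rfl fun _ _ => add_comm _ _
      · refine Finset.sum_congr rfl fun α _ => ?_
        congr 2
        ring
  · intro n
    simp [dunklOp_zero]
  · intro n f g hf hg h₁ h₂
    have hm := fun (ξ : Space d) {f : Space d → ℂ} (hf : f ∈ homPoly d (n + 1)) =>
      differentiable_of_mem (dunklOp_mem (Rp := Rp) (κ := κ) ξ hf)
    rw [dunklOp_add _ _ _ (differentiable_of_mem hf) (differentiable_of_mem hg),
      dunklOp_add _ _ _ (differentiable_of_mem hf) (differentiable_of_mem hg),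
      dunklOp_add _ _ _ (hm _ hf) (hm _ hg), dunklOp_add _ _ _ (hm _ hf) (hm _ hg), h₁, h₂]
  · intro n c f hf h
    have hm := fun (ξ : Space d) {f : Space d → ℂ} (hf : f ∈ homPoly d (n + 1)) =>
      differentiable_of_mem (dunklOp_mem (Rp := Rp) (κ := κ) ξ hf)
    rw [dunklOp_smul _ _ _ _ (differentiable_of_mem hf), dunklOp_smul _ _ _ _ (hm _ hf),
      dunklOp_smul _ _ _ _ (differentiable_of_mem hf), dunklOp_smul _ _ _ _ (hm _ hf), h]

/-! ### The Dunkl Laplacian on polynomials -/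

lemma dunklLaplacian_eq (f : Space d → ℂ) :
    dunklLaplacian Rp κ f = ∑ j, dunklD Rp κ j (dunklD Rp κ j f) := by
  ext x
  simp [dunklLaplacian]

lemma dunklLaplacian_mem {n : ℕ} {f : Space d → ℂ} (hf : f ∈ homPoly d n) :
    dunklLaplacian Rp κ f ∈ homPoly d (n - 2) := by
  rw [dunklLaplacian_eq]
  exact Submodule.sum_mem _ fun j _ => dunklOp_mem _ (dunklOp_mem _ hf)

lemma dunklLaplacian_add {m n : ℕ} {f g : Space d → ℂ} (hf : f ∈ homPoly d m)
    (hg : g ∈ homPoly d n) :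
    dunklLaplacian Rp κ (f + g) = dunklLaplacian Rp κ f + dunklLaplacian Rp κ g := by
  simp only [dunklLaplacian_eq, ← Finset.sum_add_distrib, dunklD]
  refine Finset.sum_congr rfl fun j _ => ?_
  rw [dunklOp_add _ _ _ (differentiable_of_mem hf) (differentiable_of_mem hg),
    dunklOp_add _ _ _ (differentiable_of_mem (dunklOp_mem _ hf))
      (differentiable_of_mem (dunklOp_mem _ hg))]

lemma dunklLaplacian_smul {n : ℕ} (c : ℂ) {f : Space d → ℂ} (hf : f ∈ homPoly d n) :
    dunklLaplacian Rp κ (c • f) = c • dunklLaplacian Rp κ f := by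
  simp only [dunklLaplacian_eq, Finset.smul_sum, dunklD]
  refine Finset.sum_congr rfl fun j _ => ?_
  rw [dunklOp_smul _ _ _ _ (differentiable_of_mem hf),
    dunklOp_smul _ _ _ _ (differentiable_of_mem (dunklOp_mem _ hf))]

lemma dunklLaplacian_zero : dunklLaplacian Rp κ (0 : Space d → ℂ) = 0 := by
  simp [dunklLaplacian_eq, dunklD, dunklOp_zero]

lemma dunklLaplacian_eq_zero {n : ℕ} (hn : n < 2) {f : Space d → ℂ} (hf : f ∈ homPoly d n) :
    dunklLaplacian Rp κ f = 0 := by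
  rw [dunklLaplacian_eq]
  refine Finset.sum_eq_zero fun j _ => dunklOp_eq_zero_of_mem _ ?_
  have := dunklOp_mem (Rp := Rp) (κ := κ) (EuclideanSpace.single j (1 : ℝ)) hf
  rwa [show n - 1 = 0 by omega] at this

lemma dunklLaplacian_iterate_mem {n : ℕ} {f : Space d → ℂ} (hf : f ∈ homPoly d n) (j : ℕ) :
    (dunklLaplacian Rp κ)^[j] f ∈ homPoly d (n - 2 * j) := by
  induction j with
  | zero => exact hf
  | succ j ih =>
    rw [Function.iterate_succ_apply', show n - 2 * (j + 1) = n - 2 * j - 2 by omega]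
    exact dunklLaplacian_mem ih

lemma dunklLaplacian_iterate_zero (j : ℕ) :
    (dunklLaplacian Rp κ)^[j] (0 : Space d → ℂ) = 0 := by
  induction j with
  | zero => rfl
  | succ j ih => rw [Function.iterate_succ_apply, dunklLaplacian_zero, ih]

lemma dunklLaplacian_iterate_eq_zero {n j : ℕ} (hn : n < 2 * j) {f : Space d → ℂ}
    (hf : f ∈ homPoly d n) : (dunklLaplacian Rp κ)^[j] f = 0 := by
  obtain ⟨j, rfl⟩ : ∃ k, j = k + 1 := ⟨j - 1, by omega⟩
  rw [Function.iterate_succ_apply']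
  exact dunklLaplacian_eq_zero (by omega) (dunklLaplacian_iterate_mem hf j)

lemma dunklLaplacian_iterate_add {n : ℕ} {f g : Space d → ℂ} (hf : f ∈ homPoly d n)
    (hg : g ∈ homPoly d n) (j : ℕ) : (dunklLaplacian Rp κ)^[j] (f + g) =
      (dunklLaplacian Rp κ)^[j] f + (dunklLaplacian Rp κ)^[j] g := by
  induction j with
  | zero => rfl
  | succ j ih =>
    simp only [Function.iterate_succ_apply', ih]
    exact dunklLaplacian_add (dunklLaplacian_iterate_mem hf j) (dunklLaplacian_iterate_mem hg j)

lemma dunklLaplacian_iterate_smul {n : ℕ} (c : ℂ) {f : Space d → ℂ} (hf : f ∈ homPoly d n)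
    (j : ℕ) : (dunklLaplacian Rp κ)^[j] (c • f) = c • (dunklLaplacian Rp κ)^[j] f := by
  induction j with
  | zero => rfl
  | succ j ih =>
    simp only [Function.iterate_succ_apply', ih]
    exact dunklLaplacian_smul c (dunklLaplacian_iterate_mem hf j)

lemma dunklLaplacian_dunklOp_comm (hR : IsReducedRootSystem R) (hRp : IsPositiveSystem R Rp)
    (hκ : IsMultiplicity R κ) (ξ : Space d) {n : ℕ} {f : Space d → ℂ} (hf : f ∈ homPoly d n) :
    dunklLaplacian Rp κ (dunklOp Rp κ ξ f) = dunklOp Rp κ ξ (dunklLaplacian Rp κ f) := by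
  simp only [dunklLaplacian_eq, dunklD]
  rw [dunklOp_sum _ _ _ _ _ fun j _ => differentiable_of_mem (dunklOp_mem _ (dunklOp_mem _ hf))]
  refine Finset.sum_congr rfl fun j _ => ?_
  rw [dunklOp_comm hR hRp hκ _ ξ hf, dunklOp_comm hR hRp hκ _ ξ (dunklOp_mem _ hf)]

lemma dunklOp_iterate_comm (hR : IsReducedRootSystem R) (hRp : IsPositiveSystem R Rp)
    (hκ : IsMultiplicity R κ) (ξ : Space d) {n : ℕ} {f : Space d → ℂ} (hf : f ∈ homPoly d n)
    (j : ℕ) : (dunklLaplacian Rp κ)^[j] (dunklOp Rp κ ξ f) =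
      dunklOp Rp κ ξ ((dunklLaplacian Rp κ)^[j] f) := by
  induction j with
  | zero => rfl
  | succ j ih =>
    simp only [Function.iterate_succ_apply', ih]
    exact dunklLaplacian_dunklOp_comm hR hRp hκ ξ (dunklLaplacian_iterate_mem hf j)

lemma dunklLaplacian_linMul (hR : IsReducedRootSystem R) (hRp : IsPositiveSystem R Rp)
    (hκ : IsMultiplicity R κ) (ζ : Space d) {n : ℕ} {f : Space d → ℂ} (hf : f ∈ homPoly d n) :
    dunklLaplacian Rp κ (linMul ζ f) =
      linMul ζ (dunklLaplacian Rp κ f) + (2 : ℂ) • dunklOp Rp κ ζ f := by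
  have hf' := differentiable_of_mem hf
  have hD := fun ξ => differentiable_of_mem (dunklOp_mem (Rp := Rp) (κ := κ) ξ hf)
  have step : ∀ ξ : Space d, dunklOp Rp κ ξ (dunklOp Rp κ ξ (linMul ζ f)) =
      linMul ζ (dunklOp Rp κ ξ (dunklOp Rp κ ξ f)) +
      (2 : ℂ) • (((⟪ζ, ξ⟫ : ℝ) : ℂ) • dunklOp Rp κ ξ f) +
      ∑ α ∈ Rp, (commCoeff κ α ξ ζ : ℂ) • ((dunklOp Rp κ ξ f + dunklOp Rp κ (refl α ξ) f) ∘
        refl α) := by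
    intro ξ
    have hc : ∀ α ∈ Rp, Differentiable ℝ ((commCoeff κ α ξ ζ : ℂ) • (f ∘ refl α)) :=
      fun α _ => (differentiable_of_mem (comp_refl_mem α hf)).const_smul _
    have hl : Differentiable ℝ (linMul ζ (dunklOp Rp κ ξ f)) :=
      fun x => (hasFDerivAt_linMul ζ (hD ξ x)).differentiableAt
    rw [dunklOp_linMul _ _ ξ ζ hf', dunklOp_add _ _ _ (hl.add (hf'.const_smul _))
      (Differentiable.sum hc), dunklOp_add _ _ _ hl (hf'.const_smul _),
      dunklOp_linMul _ _ ξ ζ (hD ξ), dunklOp_smul _ _ _ _ hf', dunklOp_sum _ _ _ _ _ hc]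
    have e : ∀ α ∈ Rp, dunklOp Rp κ ξ ((commCoeff κ α ξ ζ : ℂ) • (f ∘ refl α)) =
        (commCoeff κ α ξ ζ : ℂ) • (dunklOp Rp κ (refl α ξ) f ∘ refl α) := by
      intro α hα
      rw [dunklOp_smul _ _ _ _ (differentiable_of_mem (comp_refl_mem α hf)),
        dunklOp_comp_refl hR hRp hκ (hRp.mem hα)]
    rw [Finset.sum_congr rfl e]
    have e' : ∀ α ∈ Rp, (commCoeff κ α ξ ζ : ℂ) •
        ((dunklOp Rp κ ξ f + dunklOp Rp κ (refl α ξ) f) ∘ refl α) =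
        (commCoeff κ α ξ ζ : ℂ) • (dunklOp Rp κ ξ f ∘ refl α) +
        (commCoeff κ α ξ ζ : ℂ) • (dunklOp Rp κ (refl α ξ) f ∘ refl α) :=
      fun α _ => smul_add _ (dunklOp Rp κ ξ f ∘ refl α) (dunklOp Rp κ (refl α ξ) f ∘ refl α)
    rw [Finset.sum_congr rfl e', Finset.sum_add_distrib, two_smul]
    abel
  have hin : ∀ (ξ : Space d) (j : Fin d), ⟪ξ, EuclideanSpace.single j (1 : ℝ)⟫ = ξ j := by
    intro ξ j
    simp [EuclideanSpace.inner_single_right]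
  have hsum : ∑ j, ((⟪ζ, EuclideanSpace.single j (1 : ℝ)⟫ : ℝ) : ℂ) •
      dunklOp Rp κ (EuclideanSpace.single j (1 : ℝ)) f = dunklOp Rp κ ζ f := by
    simp only [hin]
    rw [dunklOp_eq_sum]
    rfl
  have hzero : ∑ j, ∑ α ∈ Rp, (commCoeff κ α (EuclideanSpace.single j (1 : ℝ)) ζ : ℂ) •
      ((dunklOp Rp κ (EuclideanSpace.single j (1 : ℝ)) f +
        dunklOp Rp κ (refl α (EuclideanSpace.single j (1 : ℝ))) f) ∘ refl α) = 0 := by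
    rw [Finset.sum_comm]
    refine Finset.sum_eq_zero fun α _ => ?_
    have e : ∀ j, (commCoeff κ α (EuclideanSpace.single j (1 : ℝ)) ζ : ℂ) •
        ((dunklOp Rp κ (EuclideanSpace.single j (1 : ℝ)) f +
          dunklOp Rp κ (refl α (EuclideanSpace.single j (1 : ℝ))) f) ∘ refl α) =
        ((κ α * (2 * ⟪ζ, α⟫ / ⟪α, α⟫) : ℝ) : ℂ) • (dunklOp Rp κ (α j •
          (EuclideanSpace.single j (1 : ℝ) + refl α (EuclideanSpace.single j (1 : ℝ)))) f ∘
            refl α) := by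
      intro j
      rw [dunklOp_smul_left, dunklOp_add_left, commCoeff, hin]
      ext x
      simp only [Pi.smul_apply, Pi.add_apply, Function.comp, smul_eq_mul]
      push_cast
      ring
    rw [Finset.sum_congr rfl fun j _ => e j, ← Finset.smul_sum]
    have e2 : ∑ j, dunklOp Rp κ (α j •
          (EuclideanSpace.single j (1 : ℝ) + refl α (EuclideanSpace.single j (1 : ℝ)))) f ∘
            refl α = dunklOp Rp κ (∑ j, α j •
          (EuclideanSpace.single j (1 : ℝ) + refl α (EuclideanSpace.single j (1 : ℝ)))) f ∘
            refl α := by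
      rw [dunklOp_sum_left]
      ext x
      simp
    have e3 : ∑ j, α j •
        (EuclideanSpace.single j (1 : ℝ) + refl α (EuclideanSpace.single j (1 : ℝ))) = 0 := by
      simp only [smul_add, Finset.sum_add_distrib, ← map_smul, ← map_sum, sum_smul_single,
        refl_self, add_neg_cancel]
    rw [e2, e3]
    ext x
    simp [dunklOp]
  rw [dunklLaplacian_eq, dunklLaplacian_eq]
  simp only [dunklD, step, Finset.sum_add_distrib]
  rw [hzero, add_zero, ← Finset.smul_sum, hsum]
  congr 1
  ext x
  simp [linMul, Finset.mul_sum]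

lemma dunklLaplacian_iterate_linMul (hR : IsReducedRootSystem R) (hRp : IsPositiveSystem R Rp)
    (hκ : IsMultiplicity R κ) (ζ : Space d) {n : ℕ} {f : Space d → ℂ} (hf : f ∈ homPoly d n)
    (j : ℕ) : (dunklLaplacian Rp κ)^[j + 1] (linMul ζ f) =
      linMul ζ ((dunklLaplacian Rp κ)^[j + 1] f) +
        (2 * (j + 1) : ℂ) • (dunklLaplacian Rp κ)^[j] (dunklOp Rp κ ζ f) := by
  induction j with
  | zero => simpa using dunklLaplacian_linMul hR hRp hκ ζ hf
  | succ j ih =>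
    have hm := dunklLaplacian_iterate_mem (Rp := Rp) (κ := κ) hf (j + 1)
    have hm' := dunklLaplacian_iterate_mem (Rp := Rp) (κ := κ)
      (dunklOp_mem (Rp := Rp) (κ := κ) ζ hf) j
    rw [Function.iterate_succ_apply', ih, dunklLaplacian_add (linMul_mem ζ hm)
      (Submodule.smul_mem _ _ hm'), dunklLaplacian_smul _ hm', dunklLaplacian_linMul hR hRp hκ ζ hm,
      ← dunklOp_iterate_comm hR hRp hκ ζ hf, ← Function.iterate_succ_apply' (dunklLaplacian Rp κ),
      ← Function.iterate_succ_apply' (dunklLaplacian Rp κ), add_assoc, ← add_smul]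
    congr 2
    push_cast
    ring

end

section

/-! ### Construction of the homogeneous components of the Dunkl kernel -/

lemma exists_smul_eq_add {V : Type*} [NormedAddCommGroup V] [NormedSpace ℝ V] [CompleteSpace V]
    (T : V →L[ℝ] V) {a c : ℝ} (ha : 0 ≤ a) (hac : a < c) (hT : ∀ v, ‖T v‖ ≤ a * ‖v‖) (w : V) :
    ∃ v : V, c • v = T v + w ∧ (c - a) * ‖v‖ ≤ ‖w‖ := by
  have hc : 0 < c := ha.trans_lt hac
  have hk : 0 ≤ a / c := by positivity
  have hcon : ContractingWith (Real.toNNReal (a / c)) fun v => c⁻¹ • (T v + w) := by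
    refine ⟨?_, LipschitzWith.of_dist_le_mul fun x y => ?_⟩
    · rw [← NNReal.coe_lt_coe, Real.coe_toNNReal _ hk]
      exact (div_lt_one hc).2 hac
    · rw [dist_eq_norm, dist_eq_norm, ← smul_sub, add_sub_add_right_eq_sub, ← map_sub, norm_smul,
        norm_inv, Real.norm_of_nonneg hc.le, Real.coe_toNNReal _ hk]
      calc c⁻¹ * ‖T (x - y)‖ ≤ c⁻¹ * (a * ‖x - y‖) := by gcongr; exact hT _
        _ = a / c * ‖x - y‖ := by ring
  have hfix := hcon.fixedPoint_isFixedPt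
  set v := hcon.fixedPoint
  have h : c • v = T v + w := by
    conv_lhs => rw [← hfix]
    simp only [smul_smul, mul_inv_cancel₀ hc.ne', one_smul]
  refine ⟨v, h, ?_⟩
  have h1 : c * ‖v‖ = ‖T v + w‖ := by
    rw [← h, norm_smul, Real.norm_of_nonneg hc.le]
  have h2 := norm_add_le (T v) w
  have h3 := hT v
  linarith

/-- Multiplication by the complex-valued linear form `l`. -/
def formMul (l : Space d →L[ℝ] ℂ) (f : Space d → ℂ) : Space d → ℂ := fun x => l x * f x

/-- `M` is the Taylor series at `0` of a joint eigenfunction of the Dunkl operators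
with eigenvalues given by `l`. -/
structure IsKernelSeries (Rp : Finset (Space d)) (κ : Space d → ℝ) (l : Space d →L[ℝ] ℂ)
    (M : FormalMultilinearSeries ℝ (Space d) ℂ) : Prop where
  zero : ∀ v, M 0 v = 1
  step : ∀ (n : ℕ) (x : Space d), ((n + 1 + gam Rp κ : ℝ) : ℂ) * M (n + 1) (fun _ => x) =
    ∑ α ∈ Rp, (κ α : ℂ) * M (n + 1) (fun _ => refl α x) + l x * M n (fun _ => x)
  bound : ∀ n, ‖M n‖ ≤ ‖l‖ ^ n / n.factorial

variable {R Rp : Finset (Space d)} {κ : Space d → ℝ}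

lemma gam_nonneg (hκ : ∀ α ∈ Rp, 0 ≤ κ α) : 0 ≤ gam Rp κ := Finset.sum_nonneg hκ

lemma exists_kernelSeries_succ (hκ : ∀ α ∈ Rp, 0 ≤ κ α) (l : Space d →L[ℝ] ℂ) (n : ℕ)
    (N : Space d [×n]→L[ℝ] ℂ) : ∃ M : Space d [×(n + 1)]→L[ℝ] ℂ,
      (∀ x : Space d, ((n + 1 + gam Rp κ : ℝ) : ℂ) * M (fun _ => x) =
        ∑ α ∈ Rp, (κ α : ℂ) * M (fun _ => refl α x) + l x * N (fun _ => x)) ∧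
      (n + 1) * ‖M‖ ≤ ‖l‖ * ‖N‖ := by
  have hγ := gam_nonneg hκ
  let T : (Space d [×(n + 1)]→L[ℝ] ℂ) →L[ℝ] (Space d [×(n + 1)]→L[ℝ] ℂ) :=
    ∑ α ∈ Rp, κ α • ContinuousMultilinearMap.compContinuousLinearMapL
      (fun _ => ((refl α).toContinuousLinearEquiv : Space d →L[ℝ] Space d))
  have hTapp : ∀ v, T v = ∑ α ∈ Rp, κ α • v.compContinuousLinearMap
      (fun _ => ((refl α).toContinuousLinearEquiv : Space d →L[ℝ] Space d)) := by
    intro v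
    simp [T]
  have hT : ∀ v, ‖T v‖ ≤ gam Rp κ * ‖v‖ := by
    intro v
    rw [hTapp, gam, Finset.sum_mul]
    refine (norm_sum_le _ _).trans (Finset.sum_le_sum fun α hα => ?_)
    rw [norm_smul, Real.norm_of_nonneg (hκ α hα)]
    gcongr
    · exact hκ α hα
    · exact (v.norm_compContinuous_linearIsometryEquiv fun _ => refl α).le
  let S : Space d →L[ℝ] (Space d [×n]→L[ℝ] ℂ) :=
    LinearMap.mkContinuous
      { toFun := fun x => l x • N
        map_add' := fun x y => by
          ext m
          simp [add_mul]
        map_smul' := fun c x => by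
          ext m
          simp [mul_assoc] } (‖l‖ * ‖N‖) (fun x => by
        change ‖l x • N‖ ≤ _
        rw [norm_smul, mul_right_comm]
        gcongr
        exact l.le_opNorm x)
  have hS : ‖S‖ ≤ ‖l‖ * ‖N‖ := LinearMap.mkContinuous_norm_le _ (by positivity) _
  obtain ⟨M, hM, hMn⟩ := exists_smul_eq_add T (c := n + 1 + gam Rp κ) hγ
    (by have : (0 : ℝ) ≤ n := n.cast_nonneg
        linarith) hT (ContinuousLinearMap.uncurryLeft S)
  refine ⟨M, fun x => ?_, ?_⟩
  · have h := congrArg (fun A => A fun _ => x) hM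
    simp only [smul_apply, add_apply, hTapp, sum_apply, Complex.real_smul,
      ContinuousMultilinearMap.compContinuousLinearMap_apply] at h
    exact h
  · rw [add_sub_cancel_right, ContinuousLinearMap.uncurryLeft_norm] at hMn
    exact hMn.trans hS

lemma exists_kernelSeries (hκ : ∀ α ∈ Rp, 0 ≤ κ α) (l : Space d →L[ℝ] ℂ) :
    ∃ M, IsKernelSeries Rp κ l M := by
  have h := exists_kernelSeries_succ hκ l
  let M : FormalMultilinearSeries ℝ (Space d) ℂ := fun n =>
    Nat.rec (motive := fun n => Space d [×n]→L[ℝ] ℂ)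
      (ContinuousMultilinearMap.constOfIsEmpty ℝ (fun _ : Fin 0 => Space d) 1)
      (fun n N => (h n N).choose) n
  refine ⟨M, fun v => rfl, fun n x => (h n (M n)).choose_spec.1 x, fun n => ?_⟩
  induction n with
  | zero =>
    refine ContinuousMultilinearMap.opNorm_le_bound (by positivity) fun m => ?_
    change ‖(1 : ℂ)‖ ≤ _
    simp
  | succ n ih =>
    have h1 : (n + 1) * ‖M (n + 1)‖ ≤ ‖l‖ * ‖M n‖ := (h n (M n)).choose_spec.2
    rw [le_div_iff₀ (by positivity), Nat.factorial_succ]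
    rw [le_div_iff₀ (by positivity)] at ih
    push_cast
    calc ‖M (n + 1)‖ * ((n + 1) * n.factorial) = (n + 1) * ‖M (n + 1)‖ * n.factorial := by ring
      _ ≤ ‖l‖ * ‖M n‖ * n.factorial := by gcongr
      _ = ‖l‖ * (‖M n‖ * n.factorial) := by ring
      _ ≤ ‖l‖ * ‖l‖ ^ n := by gcongr
      _ = ‖l‖ ^ (n + 1) := by ring

lemma inner_single (ξ : Space d) (j : Fin d) :
    ⟪EuclideanSpace.single j (1 : ℝ), ξ⟫ = ξ j := by
  simp [EuclideanSpace.inner_single_left]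

lemma diagonal_mem (n : ℕ) (M : Space d [×n]→L[ℝ] ℂ) :
    (fun x => M fun _ => x) ∈ homPoly d n := by
  induction n with
  | zero =>
    convert! const_mem (d := d) (M fun _ => 0) using 1
    ext x
    congr 1
    exact Subsingleton.elim _ _
  | succ n ih =>
    have : (fun x => M fun _ => x) = ∑ j, linMul (EuclideanSpace.single j (1 : ℝ))
        (fun x => M.curryLeft (EuclideanSpace.single j (1 : ℝ)) fun _ => x) := by
      ext x
      have h1 : (M fun _ => x) = M.curryLeft x fun _ => x := by
        rw [ContinuousMultilinearMap.curryLeft_apply]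
        congr 1
        ext i
        refine Fin.cases ?_ (fun i => ?_) i <;> simp
      have h2 : M.curryLeft x = ∑ j, x j • M.curryLeft (EuclideanSpace.single j (1 : ℝ)) := by
        conv_lhs => rw [← sum_smul_single x, map_sum]
        simp only [map_smul]
      rw [h1, h2]
      simp [linMul, inner_single]
    rw [this]
    exact Submodule.sum_mem _ fun j _ => linMul_mem _ (ih _)

lemma formMul_eq_sum (l : Space d →L[ℝ] ℂ) (f : Space d → ℂ) :
    formMul l f = ∑ j, l (EuclideanSpace.single j (1 : ℝ)) •
      linMul (EuclideanSpace.single j (1 : ℝ)) f := by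
  ext x
  have h2 : l x = ∑ j, x j • l (EuclideanSpace.single j (1 : ℝ)) := by
    conv_lhs => rw [← sum_smul_single x, map_sum]
    simp only [map_smul]
  simp only [formMul, h2, Finset.sum_mul, Finset.sum_apply, Pi.smul_apply, linMul, inner_single,
    smul_eq_mul, Complex.real_smul]
  exact Finset.sum_congr rfl fun _ _ => by ring

lemma form_inner_sum (l : Space d →L[ℝ] ℂ) (ξ : Space d) :
    ∑ j, l (EuclideanSpace.single j (1 : ℝ)) *
      ((⟪EuclideanSpace.single j (1 : ℝ), ξ⟫ : ℝ) : ℂ) = l ξ := by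
  conv_rhs => rw [← sum_smul_single ξ, map_sum]
  simp only [map_smul, inner_single, Complex.real_smul]
  exact Finset.sum_congr rfl fun _ _ => by ring

lemma differentiable_linMul (ζ : Space d) {f : Space d → ℂ} (hf : Differentiable ℝ f) :
    Differentiable ℝ (linMul ζ f) := fun x => (hasFDerivAt_linMul ζ (hf x)).differentiableAt

lemma differentiable_formMul (l : Space d →L[ℝ] ℂ) {f : Space d → ℂ} (hf : Differentiable ℝ f) :
    Differentiable ℝ (formMul l f) := l.differentiable.mul hf

lemma dunklOp_formMul (ξ : Space d) (l : Space d →L[ℝ] ℂ) {f : Space d → ℂ}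
    (hf : Differentiable ℝ f) :
    dunklOp Rp κ ξ (formMul l f) = formMul l (dunklOp Rp κ ξ f) + l ξ • f +
      ∑ α ∈ Rp, ((κ α * (2 * ⟪α, ξ⟫ / ⟪α, α⟫) : ℝ) * l α : ℂ) • (f ∘ refl α) := by
  rw [formMul_eq_sum, dunklOp_sum _ _ _ _ _ fun j _ => (differentiable_linMul _ hf).const_smul _]
  simp only [dunklOp_smul _ _ _ _ (differentiable_linMul _ hf), dunklOp_linMul _ _ _ _ hf]
  rw [formMul_eq_sum]
  simp only [smul_add, Finset.sum_add_distrib, smul_smul]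
  congr 1
  · congr 1
    rw [← Finset.sum_smul, form_inner_sum]
  · simp only [Finset.smul_sum]
    rw [Finset.sum_comm]
    refine Finset.sum_congr rfl fun α _ => ?_
    simp only [smul_smul]
    rw [← Finset.sum_smul, ← form_inner_sum l α, Finset.mul_sum]
    congr 1
    refine Finset.sum_congr rfl fun j _ => ?_
    rw [commCoeff]
    push_cast
    ring

lemma eq_zero_of_weighted_sum {X : Type*} {ι : Type*} (s : Finset ι) (a : ι → ℝ)
    (ha : ∀ i ∈ s, 0 ≤ a i) (σ : ι → X → X) {c : ℝ} (hc : ∑ i ∈ s, a i < c) (F : X → ℂ) {S : Set X}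
    (hσ : ∀ i ∈ s, ∀ z ∈ S, σ i z ∈ S) {B : ℝ} (hB : ∀ z ∈ S, ‖F z‖ ≤ B)
    (hF : ∀ z, (c : ℂ) * F z = ∑ i ∈ s, (a i : ℂ) * F (σ i z)) : ∀ z ∈ S, F z = 0 := by
  have hsum : 0 ≤ ∑ i ∈ s, a i := Finset.sum_nonneg ha
  have hc0 : 0 < c := hsum.trans_lt hc
  set q := (∑ i ∈ s, a i) / c with hq
  have hq0 : 0 ≤ q := by positivity
  have hq1 : q < 1 := (div_lt_one hc0).2 hc
  have key : ∀ k : ℕ, ∀ z ∈ S, ‖F z‖ ≤ q ^ k * B := by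
    intro k
    induction k with
    | zero => simpa using hB
    | succ k ih =>
      intro z hz
      have h1 : c * ‖F z‖ ≤ (∑ i ∈ s, a i) * (q ^ k * B) := by
        rw [← Real.norm_of_nonneg hc0.le, ← Complex.norm_real, ← norm_mul, hF, Finset.sum_mul]
        refine (norm_sum_le _ _).trans (Finset.sum_le_sum fun i hi => ?_)
        rw [norm_mul, Complex.norm_real, Real.norm_of_nonneg (ha i hi)]
        exact mul_le_mul_of_nonneg_left (ih _ (hσ i hi z hz)) (ha i hi)
      rw [pow_succ', mul_assoc, hq, div_mul_eq_mul_div, le_div_iff₀ hc0, mul_comm]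
      exact h1
  intro z hz
  have hlim : Filter.Tendsto (fun k : ℕ => q ^ k * B) Filter.atTop (nhds 0) := by
    simpa using (tendsto_pow_atTop_nhds_zero_of_lt_one hq0 hq1).mul_const B
  exact norm_le_zero_iff.1 (ge_of_tendsto' hlim fun k => key k z hz)

/-- The `n`-th homogeneous component of the function with Taylor series `M`. -/
def comp (M : FormalMultilinearSeries ℝ (Space d) ℂ) (n : ℕ) : Space d → ℂ := fun x => M n fun _ => x

lemma comp_mem (M : FormalMultilinearSeries ℝ (Space d) ℂ) (n : ℕ) : comp M n ∈ homPoly d n :=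
  diagonal_mem n (M n)

variable {l : Space d →L[ℝ] ℂ} {M : FormalMultilinearSeries ℝ (Space d) ℂ}

lemma IsKernelSeries.comp_zero (hM : IsKernelSeries Rp κ l M) : comp M 0 = fun _ => 1 :=
  funext fun _ => hM.zero _

lemma IsKernelSeries.comp_succ (hM : IsKernelSeries Rp κ l M) (n : ℕ) (x : Space d) :
    ((n + 1 + gam Rp κ : ℝ) : ℂ) * comp M (n + 1) x =
      ∑ α ∈ Rp, (κ α : ℂ) * comp M (n + 1) (refl α x) + l x * comp M n x :=
  hM.step n x

lemma dunklOp_apply_eq_sum (ξ x : Space d) (f : Space d → ℂ) :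
    dunklOp Rp κ ξ f x = ∑ j, (ξ j : ℂ) * dunklD Rp κ j f x := by
  rw [dunklOp_eq_sum]
  simp

lemma eq_zero_of_dunklOp_relation {n : ℕ} {f g : Space d → ℂ} (hf : f ∈ homPoly d n)
    (hg : Continuous g) (hκ : ∀ α ∈ Rp, 0 ≤ κ α) {c : ℝ} (hc : gam Rp κ < c)
    (h : ∀ ξ x, (c : ℂ) * (dunklOp Rp κ ξ f x - l ξ * g x) =
      ∑ α ∈ Rp, (κ α : ℂ) * (dunklOp Rp κ (refl α ξ) f (refl α x) -
        l (refl α ξ) * g (refl α x))) (ξ x : Space d) :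
    dunklOp Rp κ ξ f x = l ξ * g x := by
  set F : Space d × Space d → ℂ := fun z => dunklOp Rp κ z.1 f z.2 - l z.1 * g z.2 with hF
  have hcont : Continuous F := by
    simp only [hF, dunklOp_apply_eq_sum]
    refine Continuous.sub (continuous_finsetSum _ fun j _ => ?_) (by fun_prop)
    have : Continuous (dunklD Rp κ j f) := continuous_of_mem (dunklOp_mem _ hf)
    fun_prop
  set S : Set (Space d × Space d) := Metric.closedBall 0 ‖ξ‖ ×ˢ Metric.closedBall 0 ‖x‖
  have hS : IsCompact S := (isCompact_closedBall _ _).prod (isCompact_closedBall _ _)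
  obtain ⟨B, hB⟩ := hS.exists_bound_of_continuousOn hcont.continuousOn
  refine sub_eq_zero.1 (eq_zero_of_weighted_sum Rp κ hκ
    (fun α (z : Space d × Space d) => (refl α z.1, refl α z.2)) hc F (S := S) ?_ hB
    (fun z => h z.1 z.2) (ξ, x) ?_)
  · rintro α _ ⟨z1, z2⟩ hz
    simpa [S] using hz
  · simp [S]

lemma IsKernelSeries.dunklOp_comp_succ (hR : IsReducedRootSystem R) (hRp : IsPositiveSystem R Rp)
    (hκ : IsMultiplicity R κ) (hM : IsKernelSeries Rp κ l M) (n : ℕ) (ξ : Space d) :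
    dunklOp Rp κ ξ (comp M (n + 1)) = l ξ • comp M n := by
  have hκ0 : ∀ α ∈ Rp, 0 ≤ κ α := fun α hα => hκ.nonneg α (hRp.mem hα)
  have step : ∀ n : ℕ, (∀ ξ x, l x * dunklOp Rp κ ξ (comp M n) x =
      l ξ * (((n + gam Rp κ : ℝ) : ℂ) * comp M n x -
        ∑ α ∈ Rp, (κ α : ℂ) * comp M n (refl α x))) →
      ∀ ξ x, dunklOp Rp κ ξ (comp M (n + 1)) x = l ξ * comp M n x := by
    intro n hA
    have hEn := comp_mem M n
    have hEs := comp_mem M (n + 1)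
    refine eq_zero_of_dunklOp_relation hEs (continuous_of_mem hEn) hκ0
      (c := n + 1 + gam Rp κ) (by have : (0 : ℝ) ≤ n := n.cast_nonneg
                                  linarith) ?_
    intro ξ x
    have hrel : ((n + 1 + gam Rp κ : ℝ) : ℂ) • comp M (n + 1) =
        ∑ α ∈ Rp, (κ α : ℂ) • (comp M (n + 1) ∘ refl α) + formMul l (comp M n) := by
      ext x
      simpa [formMul] using hM.comp_succ n x
    have hd : ∀ α ∈ Rp, Differentiable ℝ ((κ α : ℂ) • (comp M (n + 1) ∘ refl α)) :=
      fun α _ => (differentiable_of_mem (comp_refl_mem α hEs)).const_smul _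
    have h := congrFun (congrArg (dunklOp Rp κ ξ) hrel) x
    have e : ∀ α ∈ Rp, dunklOp Rp κ ξ ((κ α : ℂ) • (comp M (n + 1) ∘ refl α)) =
        (κ α : ℂ) • (dunklOp Rp κ (refl α ξ) (comp M (n + 1)) ∘ refl α) := by
      intro α hα
      rw [dunklOp_smul _ _ _ _ (differentiable_of_mem (comp_refl_mem α hEs)),
        dunklOp_comp_refl hR hRp hκ (hRp.mem hα)]
    rw [dunklOp_smul _ _ _ _ (differentiable_of_mem hEs), dunklOp_add _ _ _ (Differentiable.sum hd)
      (differentiable_formMul l (differentiable_of_mem hEn)), dunklOp_sum _ _ _ _ _ hd,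
      Finset.sum_congr rfl e, dunklOp_formMul ξ l (differentiable_of_mem hEn)] at h
    simp only [Pi.smul_apply, Pi.add_apply, Finset.sum_apply, smul_eq_mul, Function.comp, formMul,
      hA] at h
    have hlr : ∀ α, l (refl α ξ) = l ξ - ((2 * ⟪α, ξ⟫ / ⟪α, α⟫ : ℝ) : ℂ) * l α := by
      intro α
      rw [refl_apply, map_sub, map_smul, Complex.real_smul]
    rw [mul_sub, h]
    simp only [mul_sub (Complex.ofReal _), Finset.sum_sub_distrib]
    rw [add_sub_assoc, sub_eq_add_neg (∑ α ∈ Rp, _), add_right_inj, ← sub_eq_zero]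
    simp only [hlr]
    have e1 : ∑ α ∈ Rp, (κ α : ℂ) * ((l ξ - ((2 * ⟪α, ξ⟫ / ⟪α, α⟫ : ℝ) : ℂ) * l α) *
        comp M n (refl α x)) = l ξ * ∑ α ∈ Rp, (κ α : ℂ) * comp M n (refl α x) -
        ∑ α ∈ Rp, ((κ α * (2 * ⟪α, ξ⟫ / ⟪α, α⟫) : ℝ) : ℂ) * l α * comp M n (refl α x) := by
      rw [Finset.mul_sum, ← Finset.sum_sub_distrib]
      refine Finset.sum_congr rfl fun α _ => ?_
      push_cast
      ring
    rw [e1]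
    push_cast
    ring
  have main : ∀ (n : ℕ) (ξ x : Space d),
      dunklOp Rp κ ξ (comp M (n + 1)) x = l ξ * comp M n x := by
    intro n
    induction n with
    | zero =>
      refine step 0 fun ξ x => ?_
      rw [hM.comp_zero, dunklOp_const]
      simp [gam]
    | succ n ih =>
      refine step (n + 1) fun ξ x => ?_
      have h := hM.comp_succ n x
      push_cast at h ⊢
      rw [ih, h]
      ring
  ext x
  exact main n ξ x

/-! ### The Dunkl kernel -/

lemma norm_comp_le (M : FormalMultilinearSeries ℝ (Space d) ℂ) (n : ℕ) (x : Space d) :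
    ‖comp M n x‖ ≤ ‖M n‖ * ‖x‖ ^ n := by
  simpa [comp] using (M n).le_opNorm fun _ => x

lemma IsKernelSeries.norm_comp_le (hM : IsKernelSeries Rp κ l M) (n : ℕ) (x : Space d) :
    ‖comp M n x‖ ≤ (‖l‖ * ‖x‖) ^ n / n.factorial := by
  refine (Dunkl.norm_comp_le M n x).trans ?_
  rw [mul_pow, mul_div_right_comm]
  gcongr
  exact hM.bound n

lemma IsKernelSeries.summable_norm_comp (hM : IsKernelSeries Rp κ l M) (x : Space d) :
    Summable fun n => ‖comp M n x‖ :=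
  Summable.of_nonneg_of_le (fun _ => norm_nonneg _) (fun n => hM.norm_comp_le n x)
    (Real.summable_pow_div_factorial _)

lemma IsKernelSeries.hasSum_comp (hM : IsKernelSeries Rp κ l M) (x : Space d) :
    HasSum (fun n => comp M n x) (M.sum x) :=
  (hM.summable_norm_comp x).of_norm.hasSum

lemma IsKernelSeries.analyticOnNhd (hM : IsKernelSeries Rp κ l M) :
    AnalyticOnNhd ℝ M.sum Set.univ := by
  have hr : M.radius = ⊤ := M.radius_eq_top_of_summable_norm fun r =>
    Summable.of_nonneg_of_le (fun _ => by positivity) (fun n => by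
      calc ‖M n‖ * (r : ℝ) ^ n ≤ ‖l‖ ^ n / n.factorial * (r : ℝ) ^ n := by
            gcongr
            exact hM.bound n
        _ = (‖l‖ * r) ^ n / n.factorial := by rw [mul_pow, mul_div_right_comm])
      (Real.summable_pow_div_factorial _)
  have h := (M.hasFPowerSeriesOnBall (by simp [hr])).analyticOnNhd
  simpa [hr] using h

lemma norm_fderiv_comp_le (M : FormalMultilinearSeries ℝ (Space d) ℂ) (n : ℕ) {x : Space d} {r : ℝ}
    (hx : ‖x‖ < r) : ‖fderiv ℝ (comp M n) x‖ ≤ ‖M n‖ * n * r ^ (n - 1) := by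
  have hr : 0 ≤ r := (norm_nonneg x).trans hx.le
  refine norm_fderiv_le_of_lip' ℝ (by positivity) ?_
  filter_upwards [Metric.isOpen_ball.mem_nhds (mem_ball_zero_iff.2 hx)] with y hy
  have h := (M n).norm_image_sub_le (fun _ => y) (fun _ => x)
  have e : ((fun _ => y) - (fun _ => x) : Fin n → Space d) = fun _ => y - x := rfl
  rw [e, Fintype.card_fin] at h
  refine h.trans ?_
  have hn := fun z : Space d => (pi_norm_const_le (ι := Fin n) z)
  gcongr
  · exact max_le ((hn y).trans (mem_ball_zero_iff.1 hy).le) ((hn x).trans hx.le)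
  · exact hn _

lemma IsKernelSeries.hasSum_fderiv (hM : IsKernelSeries Rp κ l M) (x : Space d) :
    HasSum (fun n => fderiv ℝ (comp M n) x) (fderiv ℝ M.sum x) := by
  set r := ‖x‖ + 1
  have hr : 0 ≤ r := by positivity
  have hxr : x ∈ Metric.ball (0 : Space d) r := by simp [r]
  have hu : Summable fun n : ℕ => ‖M n‖ * n * r ^ (n - 1) := by
    rw [← summable_nat_add_iff 1]
    refine Summable.of_nonneg_of_le (fun _ => by positivity) (fun n => ?_)
      ((Real.summable_pow_div_factorial (‖l‖ * r)).mul_left ‖l‖)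
    calc ‖M (n + 1)‖ * ((n + 1 : ℕ) : ℝ) * r ^ (n + 1 - 1)
        ≤ ‖l‖ ^ (n + 1) / (n + 1).factorial * ((n + 1 : ℕ) : ℝ) * r ^ (n + 1 - 1) := by
          gcongr
          exact hM.bound _
      _ = ‖l‖ * ((‖l‖ * r) ^ n / n.factorial) := by
          rw [Nat.factorial_succ, Nat.add_sub_cancel]
          push_cast
          field_simp
          rw [mul_pow, pow_succ']
          ring
  have hb : ∀ (n : ℕ), ∀ y ∈ Metric.ball (0 : Space d) r,
      ‖fderiv ℝ (comp M n) y‖ ≤ ‖M n‖ * n * r ^ (n - 1) :=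
    fun n y hy => norm_fderiv_comp_le M n (mem_ball_zero_iff.1 hy)
  have h := hasFDerivAt_tsum_of_isPreconnected hu Metric.isOpen_ball
    (convex_ball (0 : Space d) r).isPreconnected
    (fun n y _ => (differentiable_of_mem (comp_mem M n) y).hasFDerivAt) hb hxr
    (hM.summable_norm_comp x).of_norm hxr
  have h' : fderiv ℝ M.sum x = ∑' n, fderiv ℝ (comp M n) x := h.fderiv
  rw [h']
  exact (Summable.of_norm_bounded hu fun n => hb n x hxr).hasSum

lemma hasSum_diffQuot {f : ℕ → Space d → ℂ} {F : Space d → ℂ} (x α : Space d)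
    (hf : ∀ x, HasSum (fun n => f n x) (F x))
    (hf' : HasSum (fun n => fderiv ℝ (f n) x) (fderiv ℝ F x)) :
    HasSum (fun n => diffQuot α (f n) x) (diffQuot α F x) := by
  unfold diffQuot
  split_ifs
  · exact (hf'.mapL (ContinuousLinearMap.apply ℝ ℂ α)).mul_left _
  · exact ((hf x).sub (hf _)).div_const _

lemma hasSum_dunklOp {f : ℕ → Space d → ℂ} {F : Space d → ℂ} (x ξ : Space d)
    (hf : ∀ x, HasSum (fun n => f n x) (F x))
    (hf' : HasSum (fun n => fderiv ℝ (f n) x) (fderiv ℝ F x)) :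
    HasSum (fun n => dunklOp Rp κ ξ (f n) x) (dunklOp Rp κ ξ F x) :=
  (hf'.mapL (ContinuousLinearMap.apply ℝ ℂ ξ)).add
    (hasSum_sum fun α _ => (hasSum_diffQuot x α hf hf').mul_left _)

lemma IsKernelSeries.dunklOp_kernel (hR : IsReducedRootSystem R) (hRp : IsPositiveSystem R Rp)
    (hκ : IsMultiplicity R κ) (hM : IsKernelSeries Rp κ l M) (ξ x : Space d) :
    dunklOp Rp κ ξ M.sum x = l ξ * M.sum x := by
  have h := hasSum_dunklOp (Rp := Rp) (κ := κ) x ξ hM.hasSum_comp (hM.hasSum_fderiv x)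
  have h2 : HasSum (fun n => dunklOp Rp κ ξ (comp M (n + 1)) x) (l ξ * M.sum x) := by
    convert! (hM.hasSum_comp x).mul_left (l ξ) using 2 with n
    rw [hM.dunklOp_comp_succ hR hRp hκ, Pi.smul_apply, smul_eq_mul]
  have h3 := (hasSum_nat_add_iff (f := fun n => dunklOp Rp κ ξ (comp M n) x) 1).1 h2
  rw [Finset.sum_range_one, dunklOp_eq_zero_of_mem ξ (comp_mem M 0), Pi.zero_apply, add_zero] at h3
  exact h.unique h3

/-- The complex-valued linear form with coefficients `w`. -/
def coordForm (w : Fin d → ℂ) : Space d →L[ℝ] ℂ :=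
  ∑ j, (Complex.ofRealCLM.comp (EuclideanSpace.proj j)).smulRight (w j)

lemma coordForm_apply (w : Fin d → ℂ) (x : Space d) : coordForm w x = ∑ j, (x j : ℂ) * w j := by
  simp [coordForm]

lemma coordForm_single (w : Fin d → ℂ) (j : Fin d) :
    coordForm w (EuclideanSpace.single j (1 : ℝ)) = w j := by
  rw [coordForm_apply, Finset.sum_eq_single j]
  · simp
  · intro i _ hi
    simp [hi]
  · simp

lemma IsKernelSeries.isDunklKernel (hR : IsReducedRootSystem R) (hRp : IsPositiveSystem R Rp)
    (hκ : IsMultiplicity R κ) {w : Fin d → ℂ} (hM : IsKernelSeries Rp κ (coordForm w) M) :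
    IsDunklKernel Rp κ w M.sum where
  analytic := hM.analyticOnNhd
  eigen j x := by
    rw [dunklD, hM.dunklOp_kernel hR hRp hκ, coordForm_single]
  map_zero := by
    refine (hM.hasSum_comp 0).unique ?_
    rw [show (1 : ℂ) = comp M 0 0 by rw [hM.comp_zero]]
    refine hasSum_single 0 fun n hn => ?_
    have h := hM.norm_comp_le n 0
    rw [norm_zero, mul_zero, zero_pow hn, zero_div] at h
    exact norm_le_zero_iff.1 h

lemma fderiv_self_of_eigen {f : Space d → ℂ} {w : Fin d → ℂ}
    (hf : ∀ j x, dunklD Rp κ j f x = w j * f x) (x : Space d) :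
    fderiv ℝ f x x = coordForm w x * f x - ∑ α ∈ Rp, (κ α : ℂ) * (f x - f (refl α x)) := by
  have h := dunklOp_apply_eq_sum (Rp := Rp) (κ := κ) x x f
  simp only [hf, ← mul_assoc, ← Finset.sum_mul, ← coordForm_apply] at h
  rw [← h, dunklOp, eq_sub_iff_add_eq]
  congr 1
  refine Finset.sum_congr rfl fun α _ => ?_
  rw [← inner_mul_diffQuot]
  push_cast
  ring

lemma norm_le_of_eigen (hκ : ∀ α ∈ Rp, 0 ≤ κ α) {g : Space d → ℂ} {w : Fin d → ℂ}
    (hg : Differentiable ℝ g) (hD : ∀ j x, dunklD Rp κ j g x = w j * g x) {r B : ℝ}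
    (hB : ∀ z, ‖z‖ ≤ r → ‖g z‖ ≤ B * ‖z‖) {x : Space d} (hx : ‖x‖ ≤ r) :
    ‖g x‖ ≤ (1 + gam Rp κ + ‖coordForm w‖ * r) / (gam Rp κ + 2) * B * ‖x‖ := by
  have hγ := gam_nonneg hκ
  set γ := gam Rp κ
  set C := 1 + γ + ‖coordForm w‖ * r
  have hv : ∀ t : ℝ, 0 ≤ t → HasDerivAt (fun t : ℝ => ((t ^ (γ + 1) : ℝ) : ℂ) * g (t • x))
      (((t ^ γ : ℝ) : ℂ) * (g (t • x) + coordForm w (t • x) * g (t • x) +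
        ∑ α ∈ Rp, (κ α : ℂ) * g (refl α (t • x)))) t := by
    intro t ht
    have h1 : HasDerivAt (fun t : ℝ => ((t ^ (γ + 1) : ℝ) : ℂ)) (((γ + 1) * t ^ γ : ℝ) : ℂ) t := by
      have := Real.hasDerivAt_rpow_const (x := t) (p := γ + 1) (Or.inr (by linarith))
      rw [add_sub_cancel_right] at this
      exact this.ofReal_comp
    have h2 : HasDerivAt (fun t : ℝ => g (t • x)) (fderiv ℝ g (t • x) x) t := by
      have h3 : HasDerivAt (fun t : ℝ => t • x) x t := by
        simpa using (hasDerivAt_id t).smul_const x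
      exact (hg (t • x)).hasFDerivAt.comp_hasDerivAt t h3
    convert! h1.mul h2 using 1
    have h4 : (t : ℂ) * fderiv ℝ g (t • x) x = fderiv ℝ g (t • x) (t • x) := by
      rw [map_smul, Complex.real_smul]
    rw [Real.rpow_add_one' ht (by linarith)]
    push_cast
    rw [mul_assoc _ (t : ℂ), h4, fderiv_self_of_eigen hD]
    simp only [mul_sub, Finset.sum_sub_distrib, ← Finset.sum_mul]
    have : (γ : ℂ) = ∑ α ∈ Rp, (κ α : ℂ) := by simp [γ, gam]
    rw [this]
    ring
  have hBd : ∀ t : ℝ, 0 ≤ t → HasDerivAt (fun t : ℝ => C * B * ‖x‖ / (γ + 2) * t ^ (γ + 2))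
      (C * B * ‖x‖ * t ^ (γ + 1)) t := by
    intro t ht
    have := (Real.hasDerivAt_rpow_const (x := t) (p := γ + 2) (Or.inr (by linarith))).const_mul
      (C * B * ‖x‖ / (γ + 2))
    convert! this using 1
    rw [show γ + 2 - 1 = γ + 1 by ring]
    field_simp
  have hbound : ∀ t ∈ Set.Ico (0 : ℝ) 1, ‖((t ^ γ : ℝ) : ℂ) * (g (t • x) +
      coordForm w (t • x) * g (t • x) + ∑ α ∈ Rp, (κ α : ℂ) * g (refl α (t • x)))‖ ≤
      C * B * ‖x‖ * t ^ (γ + 1) := by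
    intro t ht
    have hn : ‖t • x‖ = t * ‖x‖ := by rw [norm_smul, Real.norm_of_nonneg ht.1]
    have htx : ‖t • x‖ ≤ r := by
      rw [hn]
      nlinarith [ht.2, norm_nonneg x]
    have b1 : ‖g (t • x)‖ ≤ B * (t * ‖x‖) := hn ▸ hB _ htx
    have b2 : ‖coordForm w (t • x) * g (t • x)‖ ≤ ‖coordForm w‖ * r * (B * (t * ‖x‖)) := by
      rw [norm_mul]
      have := ((coordForm w).le_opNorm (t • x)).trans
        (mul_le_mul_of_nonneg_left htx (norm_nonneg _))
      gcongr
      exact (norm_nonneg _).trans this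
    have b3 : ‖∑ α ∈ Rp, (κ α : ℂ) * g (refl α (t • x))‖ ≤ γ * (B * (t * ‖x‖)) := by
      rw [show γ = ∑ α ∈ Rp, κ α from rfl, Finset.sum_mul]
      refine (norm_sum_le _ _).trans (Finset.sum_le_sum fun α hα => ?_)
      rw [norm_mul, Complex.norm_real, Real.norm_of_nonneg (hκ α hα)]
      refine mul_le_mul_of_nonneg_left ?_ (hκ α hα)
      rw [← hn, ← LinearIsometryEquiv.norm_map (refl α)]
      exact hB _ (by rwa [LinearIsometryEquiv.norm_map])
    have ht0 : 0 ≤ t ^ γ := Real.rpow_nonneg ht.1 _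
    rw [norm_mul, Complex.norm_real, Real.norm_of_nonneg ht0, Real.rpow_add_one' ht.1 (by linarith)]
    calc t ^ γ * ‖g (t • x) + coordForm w (t • x) * g (t • x) +
          ∑ α ∈ Rp, (κ α : ℂ) * g (refl α (t • x))‖
        ≤ t ^ γ * (B * (t * ‖x‖) + ‖coordForm w‖ * r * (B * (t * ‖x‖)) + γ * (B * (t * ‖x‖))) := by
          gcongr
          exact norm_add₃_le.trans (by gcongr)
      _ = C * B * ‖x‖ * (t ^ γ * t) := by ring
  have h := image_norm_le_of_norm_deriv_right_le_deriv_boundary' (a := (0 : ℝ)) (b := 1)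
    (fun t ht => (hv t ht.1).continuousAt.continuousWithinAt)
    (fun t ht => (hv t ht.1).hasDerivWithinAt) (B := fun t => C * B * ‖x‖ / (γ + 2) * t ^ (γ + 2))
    (by rw [Real.zero_rpow (by linarith), Real.zero_rpow (by linarith)]; simp)
    (fun t ht => (hBd t ht.1).continuousAt.continuousWithinAt)
    (fun t ht => (hBd t ht.1).hasDerivWithinAt) hbound (Set.right_mem_Icc.2 zero_le_one)
  simp only [Real.one_rpow, Complex.ofReal_one, one_mul, one_smul, mul_one] at h
  calc _ ≤ _ := h
    _ = _ := by ring

lemma IsDunklKernel.unique (hκ : ∀ α ∈ Rp, 0 ≤ κ α) {w : Fin d → ℂ} {f₁ f₂ : Space d → ℂ}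
    (h₁ : IsDunklKernel Rp κ w f₁) (h₂ : IsDunklKernel Rp κ w f₂) : f₁ = f₂ := by
  have hγ := gam_nonneg hκ
  have hd₁ : Differentiable ℝ f₁ := fun x => (h₁.analytic x trivial).differentiableAt
  have hd₂ : Differentiable ℝ f₂ := fun x => (h₂.analytic x trivial).differentiableAt
  set g := f₁ + (-1 : ℂ) • f₂ with hg
  have hga : AnalyticOnNhd ℝ g Set.univ := h₁.analytic.add
    ((analyticOnNhd_const (v := (-1 : ℂ))).smul h₂.analytic)
  have hgd : Differentiable ℝ g := fun x => (hga x trivial).differentiableAt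
  have hD : ∀ j x, dunklD Rp κ j g x = w j * g x := by
    intro j x
    rw [dunklD, hg, dunklOp_add _ _ _ hd₁ (hd₂.const_smul _), dunklOp_smul _ _ _ _ hd₂]
    simp only [Pi.add_apply, Pi.smul_apply, smul_eq_mul]
    rw [← dunklD, h₁.eigen, h₂.eigen]
    ring
  have hg0 : g 0 = 0 := by simp [hg, h₁.map_zero, h₂.map_zero]
  set r := 1 / (2 * (‖coordForm w‖ + 1)) with hr
  have hr0 : 0 < r := by positivity
  obtain ⟨B, hB⟩ := (isCompact_closedBall (0 : Space d) r).exists_bound_of_continuousOn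
    (hga.contDiff.continuous_fderiv (n := 1) (by simp)).continuousOn
  have hB0 : 0 ≤ B := (norm_nonneg _).trans (hB 0 (by simp [hr0.le]))
  have hstart : ∀ z, ‖z‖ ≤ r → ‖g z‖ ≤ B * ‖z‖ := by
    intro z hz
    have := (convex_closedBall (0 : Space d) r).norm_image_sub_le_of_norm_fderiv_le
      (fun x _ => hgd x) hB (x := 0) (y := z) (by simp [hr0.le]) (by simpa using hz)
    simpa [hg0] using this
  set θ := (1 + gam Rp κ + ‖coordForm w‖ * r) / (gam Rp κ + 2) with hθ
  have hθ0 : 0 ≤ θ := by positivity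
  have hθ1 : θ < 1 := by
    rw [hθ, div_lt_one (by linarith)]
    have : ‖coordForm w‖ * r < 1 := by
      rw [hr, mul_one_div, div_lt_one (by positivity)]
      linarith [norm_nonneg (coordForm w)]
    linarith
  have hiter : ∀ k : ℕ, ∀ z, ‖z‖ ≤ r → ‖g z‖ ≤ θ ^ k * B * ‖z‖ := by
    intro k
    induction k with
    | zero => simpa using hstart
    | succ k ih =>
      intro z hz
      have := norm_le_of_eigen hκ hgd hD ih hz
      rw [pow_succ', mul_assoc θ]
      exact this
  have hzero : ∀ z, ‖z‖ ≤ r → g z = 0 := by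
    intro z hz
    have hlim : Filter.Tendsto (fun k : ℕ => θ ^ k * B * ‖z‖) Filter.atTop (nhds 0) := by
      simpa using ((tendsto_pow_atTop_nhds_zero_of_lt_one hθ0 hθ1).mul_const B).mul_const ‖z‖
    exact norm_le_zero_iff.1 (ge_of_tendsto' hlim fun k => hiter k z hz)
  have hev : g =ᶠ[nhds 0] 0 := by
    filter_upwards [Metric.closedBall_mem_nhds (0 : Space d) hr0] with z hz
    exact hzero z (by simpa using hz)
  have hall := hga.eqOn_zero_of_preconnected_of_eventuallyEq_zero isPreconnected_univ
    (Set.mem_univ 0) hev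
  ext x
  have := hall (Set.mem_univ x)
  simpa [hg, ← sub_eq_add_neg, sub_eq_zero] using this

lemma IsKernelSeries.dunklKernel_eq (hR : IsReducedRootSystem R) (hRp : IsPositiveSystem R Rp)
    (hκ : IsMultiplicity R κ) {w : Fin d → ℂ} (hM : IsKernelSeries Rp κ (coordForm w) M)
    (x : Space d) : dunklKernel Rp κ x w = M.sum x := by
  have hk := hM.isDunklKernel hR hRp hκ
  have h : ∃ f, IsDunklKernel Rp κ w f := ⟨_, hk⟩
  rw [dunklKernel, dif_pos h,
    h.choose_spec.unique (fun α hα => hκ.nonneg α (hRp.mem hα)) hk]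

end

section

/-! ### Gaussian bounds and integrability -/

/-- The dominating function `(1 + ‖x‖)^N e^{-‖x‖²/2}`. -/
def gaussBound (N : ℕ) (x : Space d) : ℝ := (1 + ‖x‖) ^ N * Real.exp (-‖x‖ ^ 2 / 2)

lemma gaussBound_nonneg (N : ℕ) (x : Space d) : 0 ≤ gaussBound N x := by
  unfold gaussBound
  positivity

lemma integrable_gaussBound (N : ℕ) : Integrable (gaussBound N : Space d → ℝ) := by
  have h0 : Integrable fun x : Space d => Real.exp (-(1 / 4) * ‖x‖ ^ 2) := by
    have h := (GaussianFourier.integrable_cexp_neg_mul_sq_norm_add (V := Space d) (b := 1 / 4)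
      (by norm_num) 0 0).norm
    refine h.congr (Filter.Eventually.of_forall fun x => ?_)
    simp only [Complex.norm_exp]
    congr 1
    have : (-(1 / 4) * (‖x‖ : ℂ) ^ 2 + 0 * ((⟪(0 : Space d), x⟫ : ℝ) : ℂ)) =
        ((-(1 / 4) * ‖x‖ ^ 2 : ℝ) : ℂ) := by
      push_cast
      ring
    rw [this, Complex.ofReal_re]
  refine (h0.const_mul (N.factorial * Real.exp 2)).mono' ?_
    (Filter.Eventually.of_forall fun x => ?_)
  · exact (by unfold gaussBound; fun_prop : Continuous (gaussBound N)).aestronglyMeasurable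
  · rw [Real.norm_of_nonneg (gaussBound_nonneg N x), gaussBound]
    have h1 := Real.pow_div_factorial_le_exp (1 + ‖x‖) (by positivity) N
    rw [div_le_iff₀ (by positivity)] at h1
    have h2 : Real.exp (1 + ‖x‖) ≤ Real.exp (2 + ‖x‖ ^ 2 / 4) := by
      rw [Real.exp_le_exp]
      nlinarith [sq_nonneg (‖x‖ / 2 - 1)]
    calc (1 + ‖x‖) ^ N * Real.exp (-‖x‖ ^ 2 / 2)
        ≤ Real.exp (2 + ‖x‖ ^ 2 / 4) * N.factorial * Real.exp (-‖x‖ ^ 2 / 2) := by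
          gcongr
          exact h1.trans (by gcongr)
      _ = N.factorial * Real.exp 2 * Real.exp (-(1 / 4) * ‖x‖ ^ 2) := by
          rw [mul_right_comm, ← Real.exp_add, mul_assoc, ← Real.exp_add, mul_comm]
          congr 2
          ring

lemma integrable_of_norm_le_gaussBound {F : Space d → ℂ} (hF : AEStronglyMeasurable F) {C : ℝ}
    {N : ℕ} (h : ∀ x, ‖F x‖ ≤ C * gaussBound N x) : Integrable F :=
  ((integrable_gaussBound N).const_mul C).mono' hF (Filter.Eventually.of_forall h)

lemma exists_norm_le_of_mem {n : ℕ} {f : Space d → ℂ} (hf : f ∈ homPoly d n) :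
    ∃ C : ℝ, 0 ≤ C ∧ ∀ x, ‖f x‖ ≤ C * (1 + ‖x‖) ^ n := by
  refine homPoly_induction (motive := fun n f =>
    ∃ C : ℝ, 0 ≤ C ∧ ∀ x, ‖f x‖ ≤ C * (1 + ‖x‖) ^ n) ?_ ?_ ?_ ?_ ?_ hf
  · exact fun c => ⟨‖c‖, norm_nonneg _, by simp⟩
  · rintro n ζ f - ⟨C, hC, h⟩
    refine ⟨‖ζ‖ * C, by positivity, fun x => ?_⟩
    rw [linMul, norm_mul, Complex.norm_real, pow_succ]
    calc ‖⟪ζ, x⟫‖ * ‖f x‖ ≤ (‖ζ‖ * (1 + ‖x‖)) * (C * (1 + ‖x‖) ^ n) := by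
          gcongr
          · exact (norm_inner_le_norm ζ x).trans (by gcongr; linarith)
          · exact h x
      _ = _ := by ring
  · exact fun n => ⟨0, le_rfl, by simp⟩
  · rintro n f g - - ⟨C, hC, h⟩ ⟨C', hC', h'⟩
    refine ⟨C + C', by positivity, fun x => ?_⟩
    rw [add_mul]
    exact norm_add_le_of_le (h x) (h' x)
  · rintro n c f - ⟨C, hC, h⟩
    refine ⟨‖c‖ * C, by positivity, fun x => ?_⟩
    rw [Pi.smul_apply, norm_smul, mul_assoc]
    gcongr
    exact h x

lemma gaussBound_mul_pow (m N : ℕ) (x : Space d) :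
    (1 + ‖x‖) ^ m * gaussBound N x = gaussBound (m + N) x := by
  rw [gaussBound, gaussBound, pow_add, mul_assoc]

/-! ### The weight and its regularization -/

variable (Rp : Finset (Space d)) (κ : Space d → ℝ)

/-- The weight `h_κ²(x) e^{-‖x‖²/2}`. -/
def gaussWeight (x : Space d) : ℝ := weight Rp κ x ^ 2 * Real.exp (-‖x‖ ^ 2 / 2)

/-- A smooth positive regularization of `gaussWeight`. -/
def regWeight (ε : ℝ) (x : Space d) : ℝ :=
  Real.exp (∑ α ∈ Rp, κ α * Real.log (⟪α, x⟫ ^ 2 + ε) - ‖x‖ ^ 2 / 2)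

variable {R : Finset (Space d)} {Rp κ}

lemma regWeight_eq {ε : ℝ} (hε : 0 < ε) (x : Space d) : regWeight Rp κ ε x =
    (∏ α ∈ Rp, (⟪α, x⟫ ^ 2 + ε) ^ κ α) * Real.exp (-‖x‖ ^ 2 / 2) := by
  rw [regWeight, sub_eq_add_neg, Real.exp_add, Real.exp_sum, neg_div]
  congr 1
  refine Finset.prod_congr rfl fun α _ => ?_
  rw [Real.rpow_def_of_pos (by positivity), mul_comm]

lemma tendsto_regWeight (hκ : ∀ α ∈ Rp, 0 ≤ κ α) (x : Space d) :
    Filter.Tendsto (fun ε => regWeight Rp κ ε x) (nhdsWithin 0 (Set.Ioi 0))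
      (nhds (gaussWeight Rp κ x)) := by
  have h : Filter.Tendsto (fun ε : ℝ => (∏ α ∈ Rp, (⟪α, x⟫ ^ 2 + ε) ^ κ α) *
      Real.exp (-‖x‖ ^ 2 / 2)) (nhds 0) (nhds (gaussWeight Rp κ x)) := by
    have e : gaussWeight Rp κ x = (∏ α ∈ Rp, (⟪α, x⟫ ^ 2 + 0) ^ κ α) *
        Real.exp (-‖x‖ ^ 2 / 2) := by
      rw [gaussWeight, weight, ← Finset.prod_pow]
      congr 1
      refine Finset.prod_congr rfl fun α _ => ?_
      rw [Real.rpow_pow_comm (abs_nonneg _), sq_abs, add_zero]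
    rw [e]
    refine Filter.Tendsto.mul_const _ (tendsto_finsetProd _ fun α hα => ?_)
    have hc : Continuous fun ε : ℝ => (⟪α, x⟫ ^ 2 + ε) ^ κ α :=
      (by fun_prop : Continuous fun ε : ℝ => ⟪α, x⟫ ^ 2 + ε).rpow_const
        fun _ => Or.inr (hκ α hα)
    exact hc.tendsto 0
  refine (h.mono_left nhdsWithin_le_nhds).congr' ?_
  filter_upwards [self_mem_nhdsWithin] with ε hε
  exact (regWeight_eq hε x).symm

lemma regWeight_pos (ε : ℝ) (x : Space d) : 0 < regWeight Rp κ ε x := Real.exp_pos _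

lemma gaussWeight_nonneg (x : Space d) : 0 ≤ gaussWeight Rp κ x := by
  unfold gaussWeight
  positivity

lemma exists_regWeight_le (hκ : ∀ α ∈ Rp, 0 ≤ κ α) : ∃ (K : ℝ) (N : ℕ), 0 ≤ K ∧
    ∀ ε ∈ Set.Ioc (0 : ℝ) 1, ∀ x, regWeight Rp κ ε x ≤ K * gaussBound N x := by
  have hγ := gam_nonneg hκ
  refine ⟨Real.exp (∑ α ∈ Rp, κ α * (2 * Real.log (1 + ‖α‖))), ⌈2 * gam Rp κ⌉₊, by positivity,
    fun ε hε x => ?_⟩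
  have hx : 0 < 1 + ‖x‖ := by positivity
  have hx0 : 0 ≤ Real.log (1 + ‖x‖) := Real.log_nonneg (by linarith [norm_nonneg x])
  have h1 : ∀ α ∈ Rp, κ α * Real.log (⟪α, x⟫ ^ 2 + ε) ≤
      κ α * (2 * Real.log (1 + ‖α‖)) + κ α * (2 * Real.log (1 + ‖x‖)) := by
    intro α hα
    rw [← mul_add]
    refine mul_le_mul_of_nonneg_left ?_ (hκ α hα)
    have hα' : 0 < 1 + ‖α‖ := by positivity
    have e : 2 * Real.log (1 + ‖α‖) + 2 * Real.log (1 + ‖x‖) =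
        Real.log (((1 + ‖α‖) * (1 + ‖x‖)) ^ 2) := by
      rw [Real.log_pow, Real.log_mul hα'.ne' hx.ne']
      push_cast
      ring
    rw [e]
    refine Real.log_le_log (by have := hε.1; positivity) ?_
    have hi : ⟪α, x⟫ ^ 2 ≤ (‖α‖ * ‖x‖) ^ 2 :=
      sq_le_sq' (by linarith [neg_le_of_abs_le (abs_real_inner_le_norm α x)])
        (real_inner_le_norm α x)
    have := hε.2
    have ha := norm_nonneg α
    have hb := norm_nonneg x
    have hab := mul_nonneg ha hb
    nlinarith [mul_nonneg ha hab, mul_nonneg hb hab]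
  have h2 : ∑ α ∈ Rp, κ α * Real.log (⟪α, x⟫ ^ 2 + ε) ≤
      ∑ α ∈ Rp, κ α * (2 * Real.log (1 + ‖α‖)) +
        ⌈2 * gam Rp κ⌉₊ * Real.log (1 + ‖x‖) := by
    refine (Finset.sum_le_sum h1).trans ?_
    rw [Finset.sum_add_distrib, ← Finset.sum_mul, show ∑ α ∈ Rp, κ α = gam Rp κ from rfl]
    have := Nat.le_ceil (2 * gam Rp κ)
    nlinarith
  calc regWeight Rp κ ε x ≤ Real.exp (∑ α ∈ Rp, κ α * (2 * Real.log (1 + ‖α‖)) +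
        ⌈2 * gam Rp κ⌉₊ * Real.log (1 + ‖x‖) + -‖x‖ ^ 2 / 2) := by
        rw [regWeight, Real.exp_le_exp]
        linarith
    _ = _ := by
        rw [Real.exp_add, Real.exp_add, gaussBound, mul_comm (⌈2 * gam Rp κ⌉₊ : ℝ),
          ← Real.rpow_def_of_pos hx, Real.rpow_natCast, mul_assoc]

lemma exists_gaussWeight_le (hκ : ∀ α ∈ Rp, 0 ≤ κ α) : ∃ (K : ℝ) (N : ℕ), 0 ≤ K ∧
    ∀ x, gaussWeight Rp κ x ≤ K * gaussBound N x := by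
  obtain ⟨K, N, hK, h⟩ := exists_regWeight_le hκ
  refine ⟨K, N, hK, fun x => le_of_tendsto (tendsto_regWeight hκ x) ?_⟩
  filter_upwards [Ioc_mem_nhdsGT (zero_lt_one (α := ℝ))] with ε hε
  exact h ε hε x

lemma continuous_weight (hκ : ∀ α ∈ Rp, 0 ≤ κ α) : Continuous (weight Rp κ) := by
  unfold weight
  refine continuous_finsetProd _ fun α hα => ?_
  exact (by fun_prop : Continuous fun x : Space d => |⟪α, x⟫|).rpow_const
    fun _ => Or.inr (hκ α hα)

lemma continuous_gaussWeight (hκ : ∀ α ∈ Rp, 0 ≤ κ α) : Continuous (gaussWeight Rp κ) :=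
  ((continuous_weight hκ).pow 2).mul (by fun_prop)

lemma hasFDerivAt_regWeight {ε : ℝ} (hε : 0 < ε) (x : Space d) :
    HasFDerivAt (fun x => (regWeight Rp κ ε x : ℂ)) (Complex.ofRealCLM.comp (regWeight Rp κ ε x •
      (∑ α ∈ Rp, (κ α * (2 * ⟪α, x⟫ / (⟪α, x⟫ ^ 2 + ε))) • innerSL ℝ α - innerSL ℝ x))) x := by
  refine Complex.ofRealCLM.hasFDerivAt.comp x (HasFDerivAt.exp (HasFDerivAt.sub ?_ ?_))
  · refine HasFDerivAt.fun_sum fun α _ => ?_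
    have h1 : HasFDerivAt (fun x : Space d => ⟪α, x⟫) (innerSL ℝ α) x := (innerSL ℝ α).hasFDerivAt
    have h2 := (((h1.pow 2).add_const ε).log (by positivity)).const_mul (κ α)
    convert! h2 using 1
    ext y
    simp
    ring
  · have h := ((hasStrictFDerivAt_norm_sq x).hasFDerivAt).const_mul (1 / 2 : ℝ)
    convert! h using 1
    · ext y
      ring
    · ext y
      simp

lemma continuous_regWeight {ε : ℝ} (hε : 0 < ε) : Continuous (regWeight Rp κ ε) := by
  have : Continuous fun x => (regWeight Rp κ ε x : ℂ) :=
    continuous_iff_continuousAt.2 fun x => (hasFDerivAt_regWeight hε x).continuousAt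
  convert! Complex.continuous_re.comp this using 1

lemma weight_refl (hR : IsReducedRootSystem R) (hRp : IsPositiveSystem R Rp)
    (hκ : IsMultiplicity R κ) {β : Space d} (hβ : β ∈ R) (x : Space d) :
    weight Rp κ (refl β x) = weight Rp κ x := by
  unfold weight
  rw [← prod_posRoots_refl hR hRp hβ (fun α => |⟪α, x⟫| ^ κ α)]
  · refine Finset.prod_congr rfl fun α hα => ?_
    rw [inner_refl, hκ.refl hβ (hRp.mem hα)]
  · intro α hα
    rw [inner_neg_left, abs_neg, hκ.neg hα]

lemma gaussWeight_refl (hR : IsReducedRootSystem R) (hRp : IsPositiveSystem R Rp)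
    (hκ : IsMultiplicity R κ) {β : Space d} (hβ : β ∈ R) (x : Space d) :
    gaussWeight Rp κ (refl β x) = gaussWeight Rp κ x := by
  rw [gaussWeight, weight_refl hR hRp hκ hβ, LinearIsometryEquiv.norm_map, gaussWeight]

lemma regWeight_refl (hR : IsReducedRootSystem R) (hRp : IsPositiveSystem R Rp)
    (hκ : IsMultiplicity R κ) {β : Space d} (hβ : β ∈ R) (ε : ℝ) (x : Space d) :
    regWeight Rp κ ε (refl β x) = regWeight Rp κ ε x := by
  unfold regWeight
  rw [← sum_posRoots_refl hR hRp hβ (fun α => κ α * Real.log (⟪α, x⟫ ^ 2 + ε)),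
    LinearIsometryEquiv.norm_map]
  · congr 2
    refine Finset.sum_congr rfl fun α hα => ?_
    rw [inner_refl, hκ.refl hβ (hRp.mem hα)]
  · intro α hα
    rw [inner_neg_left, neg_sq, hκ.neg hα]

lemma integral_comp_refl (β : Space d) (F : Space d → ℂ) :
    ∫ x, F (refl β x) = ∫ x, F x :=
  (refl β).measurePreserving.integral_comp (refl β).toHomeomorph.measurableEmbedding F

lemma integrable_mul_weight {g : Space d → ℝ} (hg : Continuous g) (hg0 : ∀ x, 0 ≤ g x) {K : ℝ}
    {N : ℕ} (hK : ∀ x, g x ≤ K * gaussBound N x) {n : ℕ} {f : Space d → ℂ}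
    (hf : f ∈ homPoly d n) : Integrable fun x => f x * (g x : ℂ) := by
  obtain ⟨C, hC, h⟩ := exists_norm_le_of_mem hf
  have hcont : Continuous fun x => f x * (g x : ℂ) :=
    (continuous_of_mem hf).mul (Complex.continuous_ofReal.comp hg)
  refine integrable_of_norm_le_gaussBound hcont.aestronglyMeasurable
    (C := C * K) (N := n + N) fun x => ?_
  rw [norm_mul, Complex.norm_real, Real.norm_of_nonneg (hg0 x), ← gaussBound_mul_pow]
  calc ‖f x‖ * g x ≤ (C * (1 + ‖x‖) ^ n) * (K * gaussBound N x) :=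
        mul_le_mul (h x) (hK x) (hg0 x) (by positivity)
    _ = _ := by ring

lemma integrable_gaussWeight (hκ : ∀ α ∈ Rp, 0 ≤ κ α) {n : ℕ} {f : Space d → ℂ}
    (hf : f ∈ homPoly d n) : Integrable fun x => f x * (gaussWeight Rp κ x : ℂ) := by
  obtain ⟨K, N, -, h⟩ := exists_gaussWeight_le hκ
  exact integrable_mul_weight (continuous_gaussWeight hκ) gaussWeight_nonneg h hf

lemma integrable_regWeight (hκ : ∀ α ∈ Rp, 0 ≤ κ α) {ε : ℝ} (hε : ε ∈ Set.Ioc (0 : ℝ) 1) {n : ℕ}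
    {f : Space d → ℂ} (hf : f ∈ homPoly d n) :
    Integrable fun x => f x * (regWeight Rp κ ε x : ℂ) := by
  obtain ⟨K, N, -, h⟩ := exists_regWeight_le hκ
  exact integrable_mul_weight (continuous_regWeight hε.1) (fun x => (regWeight_pos ε x).le)
    (h ε hε) hf

/-! ### Skew-symmetry of Dunkl operators -/

lemma fderiv_mem (ξ : Space d) {n : ℕ} {f : Space d → ℂ} (hf : f ∈ homPoly d n) :
    (fun x => fderiv ℝ f x ξ) ∈ homPoly d (n - 1) := by
  have h := dunklOp_mem (Rp := ∅) (κ := 0) ξ hf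
  convert! h using 1
  ext x
  simp [dunklOp]

lemma diffQuot_mem {α : Space d} (hα : α ≠ 0) {n : ℕ} {f : Space d → ℂ} (hf : f ∈ homPoly d n) :
    diffQuot α f ∈ homPoly d (n - 1) := by
  have h := dunklOp_mem (Rp := {α}) (κ := 1) α hf
  have h' := Submodule.smul_mem _ (((⟪α, α⟫ : ℝ) : ℂ)⁻¹) (Submodule.sub_mem _ h (fderiv_mem α hf))
  convert! h' using 1
  ext x
  have : ((⟪α, α⟫ : ℝ) : ℂ) ≠ 0 := by
    exact_mod_cast (inner_self_ne_zero (𝕜 := ℝ)).2 hα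
  simp only [dunklOp, Finset.sum_singleton, Pi.one_apply, one_mul, Pi.smul_apply, Pi.sub_apply,
    add_sub_cancel_left, smul_eq_mul]
  rw [inv_mul_cancel_left₀ this]

lemma ae_inner_ne_zero {α : Space d} (hα : α ≠ 0) : ∀ᵐ x : Space d, ⟪α, x⟫ ≠ 0 := by
  have h : (volume : Measure (Space d)) ((Submodule.span ℝ {α})ᗮ : Submodule ℝ (Space d)) = 0 := by
    refine Measure.addHaar_submodule _ _ fun htop => hα ?_
    have : α ∈ (Submodule.span ℝ {α})ᗮ := htop ▸ Submodule.mem_top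
    exact inner_self_eq_zero.1 (Submodule.mem_orthogonal_singleton_iff_inner_right.1 this)
  rw [ae_iff]
  convert! h using 2
  ext x
  simp [Submodule.mem_orthogonal_singleton_iff_inner_right]

/-- The regularizing factor `⟨α, x⟩² / (⟨α, x⟩² + ε)`. -/
def regFactor (α : Space d) (ε : ℝ) (x : Space d) : ℝ := ⟪α, x⟫ ^ 2 / (⟪α, x⟫ ^ 2 + ε)

lemma regFactor_mem {ε : ℝ} (hε : 0 < ε) (α x : Space d) :
    0 ≤ regFactor α ε x ∧ regFactor α ε x ≤ 1 := by
  unfold regFactor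
  refine ⟨by positivity, ?_⟩
  rw [div_le_one (by positivity)]
  linarith

lemma continuous_regFactor {ε : ℝ} (hε : 0 < ε) (α : Space d) : Continuous (regFactor α ε) := by
  unfold regFactor
  refine Continuous.div (by fun_prop) (by fun_prop) fun x => by positivity

lemma integral_regWeight_singular (hR : IsReducedRootSystem R) (hRp : IsPositiveSystem R Rp)
    (hκ : IsMultiplicity R κ) {ε : ℝ} (hε : ε ∈ Set.Ioc (0 : ℝ) 1) {n : ℕ}
    {f : Space d → ℂ} (hf : f ∈ homPoly d n) {α : Space d} (hα : α ∈ R) :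
    Integrable (fun x => ((2 * ⟪α, x⟫ / (⟪α, x⟫ ^ 2 + ε) : ℝ) : ℂ) *
      (f x * (regWeight Rp κ ε x : ℂ))) ∧
    ∫ x, ((2 * ⟪α, x⟫ / (⟪α, x⟫ ^ 2 + ε) : ℝ) : ℂ) * (f x * (regWeight Rp κ ε x : ℂ)) =
      ∫ x, (regFactor α ε x : ℂ) * (diffQuot α f x * (regWeight Rp κ ε x : ℂ)) := by
  have hκ0 : ∀ α ∈ Rp, 0 ≤ κ α := fun α hα => hκ.nonneg α (hRp.mem hα)
  have hε0 := hε.1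
  have hint : ∀ {f : Space d → ℂ}, f ∈ homPoly d n →
      Integrable (fun x => ((⟪α, x⟫ / (⟪α, x⟫ ^ 2 + ε) : ℝ) : ℂ) *
        (f x * (regWeight Rp κ ε x : ℂ))) := by
    intro f hf
    refine (integrable_regWeight hκ0 hε hf).bdd_mul (c := 1 / ε) ?_
      (Filter.Eventually.of_forall fun x => ?_)
    · refine (Complex.continuous_ofReal.comp ?_).aestronglyMeasurable
      exact Continuous.div (by fun_prop) (by fun_prop) fun x => by positivity
    · rw [Complex.norm_real, Real.norm_eq_abs, abs_div, abs_of_pos (a := ⟪α, x⟫ ^ 2 + ε)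
        (by positivity), div_le_div_iff₀ (by positivity) hε0, one_mul, ← sq_abs]
      have := hε.2
      nlinarith [sq_nonneg (|⟪α, x⟫| - 1), sq_nonneg (|⟪α, x⟫| - ε), abs_nonneg ⟪α, x⟫]
  have hrefl : ∫ x, ((⟪α, x⟫ / (⟪α, x⟫ ^ 2 + ε) : ℝ) : ℂ) * (f x * (regWeight Rp κ ε x : ℂ)) =
      -∫ x, ((⟪α, x⟫ / (⟪α, x⟫ ^ 2 + ε) : ℝ) : ℂ) *
        ((f ∘ refl α) x * (regWeight Rp κ ε x : ℂ)) := by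
    rw [← integral_comp_refl α, ← integral_neg]
    congr 1
    ext x
    rw [inner_self_refl, neg_sq, regWeight_refl hR hRp hκ hα, neg_div, Complex.ofReal_neg, neg_mul]
    rfl
  have hf' := comp_refl_mem α hf
  have htwo : (fun x => ((2 * ⟪α, x⟫ / (⟪α, x⟫ ^ 2 + ε) : ℝ) : ℂ) *
      (f x * (regWeight Rp κ ε x : ℂ))) = fun x => 2 * (((⟪α, x⟫ / (⟪α, x⟫ ^ 2 + ε) : ℝ) : ℂ) *
      (f x * (regWeight Rp κ ε x : ℂ))) := by
    ext x
    push_cast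
    ring
  refine ⟨htwo ▸ (hint hf).const_mul 2, ?_⟩
  rw [htwo, integral_const_mul, two_mul]
  nth_rewrite 2 [hrefl]
  rw [← sub_eq_add_neg, ← integral_sub (hint hf) (hint hf')]
  congr 1
  ext x
  rw [← mul_sub, ← sub_mul, Function.comp_apply, ← inner_mul_diffQuot, regFactor]
  push_cast
  ring

lemma integral_regWeight_parts (hR : IsReducedRootSystem R) (hRp : IsPositiveSystem R Rp)
    (hκ : IsMultiplicity R κ) {ε : ℝ} (hε : ε ∈ Set.Ioc (0 : ℝ) 1) {n : ℕ}
    {f : Space d → ℂ} (hf : f ∈ homPoly d n) (ξ : Space d) :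
    (∫ x, fderiv ℝ f x ξ * (regWeight Rp κ ε x : ℂ)) + ∑ α ∈ Rp, ((κ α * ⟪α, ξ⟫ : ℝ) : ℂ) *
      ∫ x, (regFactor α ε x : ℂ) * (diffQuot α f x * (regWeight Rp κ ε x : ℂ)) =
      ∫ x, linMul ξ f x * (regWeight Rp κ ε x : ℂ) := by
  have hκ0 : ∀ α ∈ Rp, 0 ≤ κ α := fun α hα => hκ.nonneg α (hRp.mem hα)
  have hε0 := hε.1
  have hfd : ∀ x, f x * fderiv ℝ (fun x => (regWeight Rp κ ε x : ℂ)) x ξ =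
      ∑ α ∈ Rp, ((κ α * ⟪α, ξ⟫ : ℝ) : ℂ) * (((2 * ⟪α, x⟫ / (⟪α, x⟫ ^ 2 + ε) : ℝ) : ℂ) *
        (f x * (regWeight Rp κ ε x : ℂ))) - linMul ξ f x * (regWeight Rp κ ε x : ℂ) := by
    intro x
    rw [(hasFDerivAt_regWeight hε0 x).fderiv, linMul, real_inner_comm]
    simp only [ContinuousLinearMap.comp_apply, smul_apply, sub_apply, sum_apply, innerSL_apply_apply,
      smul_eq_mul, Complex.ofRealCLM_apply, Complex.ofReal_mul, Complex.ofReal_sub,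
      Complex.ofReal_sum, mul_sub, Finset.mul_sum]
    congr 1
    · exact Finset.sum_congr rfl fun α _ => by ring
    · ring
  have hs := fun (α : Space d) (hα : α ∈ Rp) =>
    integral_regWeight_singular hR hRp hκ hε hf (hRp.mem hα)
  have hl := integrable_regWeight hκ0 hε (linMul_mem ξ hf)
  have hsum : Integrable fun x => ∑ α ∈ Rp, ((κ α * ⟪α, ξ⟫ : ℝ) : ℂ) *
      (((2 * ⟪α, x⟫ / (⟪α, x⟫ ^ 2 + ε) : ℝ) : ℂ) * (f x * (regWeight Rp κ ε x : ℂ))) :=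
    integrable_finsetSum _ fun α hα => (hs α hα).1.const_mul _
  have h := integral_mul_fderiv_eq_neg_fderiv_mul_of_integrable (μ := (volume : Measure (Space d)))
    (f := f) (g := fun x => (regWeight Rp κ ε x : ℂ)) (v := ξ)
    (integrable_regWeight hκ0 hε (fderiv_mem ξ hf))
    (by simp only [hfd]; exact hsum.sub hl)
    (integrable_regWeight hκ0 hε hf) (fun x _ => differentiable_of_mem hf x)
    (fun x _ => (hasFDerivAt_regWeight hε0 x).differentiableAt)
  simp only [hfd] at h
  rw [integral_sub hsum hl, integral_finsetSum _ fun α hα => (hs α hα).1.const_mul _] at h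
  simp only [integral_const_mul] at h
  rw [Finset.sum_congr rfl fun α hα => by rw [(hs α hα).2]] at h
  linear_combination h

lemma tendsto_integral_regWeight (hκ : ∀ α ∈ Rp, 0 ≤ κ α) {n : ℕ} {f : Space d → ℂ}
    (hf : f ∈ homPoly d n) (c : ℝ → Space d → ℝ) (hc : ∀ ε, 0 < ε → Continuous (c ε))
    (hc1 : ∀ ε, 0 < ε → ∀ x, |c ε x| ≤ 1)
    (hlim : ∀ᵐ x, Filter.Tendsto (fun ε => c ε x) (nhdsWithin 0 (Set.Ioi 0)) (nhds 1)) :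
    Filter.Tendsto (fun ε => ∫ x, (c ε x : ℂ) * (f x * (regWeight Rp κ ε x : ℂ)))
      (nhdsWithin 0 (Set.Ioi 0)) (nhds (∫ x, f x * (gaussWeight Rp κ x : ℂ))) := by
  obtain ⟨K, N, hK, h⟩ := exists_regWeight_le hκ
  obtain ⟨C, hC, hfC⟩ := exists_norm_le_of_mem hf
  refine tendsto_integral_filter_of_dominated_convergence
    (fun x => C * K * gaussBound (n + N) x) ?_ ?_ ((integrable_gaussBound _).const_mul _) ?_
  · filter_upwards [self_mem_nhdsWithin] with ε hε
    have h1 : Continuous fun x => (regWeight Rp κ ε x : ℂ) :=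
      Complex.continuous_ofReal.comp (continuous_regWeight hε)
    have h2 : Continuous fun x => (c ε x : ℂ) := Complex.continuous_ofReal.comp (hc ε hε)
    exact (h2.mul ((continuous_of_mem hf).mul h1)).aestronglyMeasurable
  · filter_upwards [Ioc_mem_nhdsGT (zero_lt_one (α := ℝ))] with ε hε
    refine Filter.Eventually.of_forall fun x => ?_
    rw [norm_mul, norm_mul, Complex.norm_real, Complex.norm_real,
      Real.norm_of_nonneg (regWeight_pos ε x).le, ← gaussBound_mul_pow]
    calc ‖c ε x‖ * (‖f x‖ * regWeight Rp κ ε x)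
        ≤ 1 * ((C * (1 + ‖x‖) ^ n) * (K * gaussBound N x)) := by
          gcongr
          · exact mul_nonneg (norm_nonneg _) (regWeight_pos ε x).le
          · exact hc1 ε hε.1 x
          · exact (regWeight_pos ε x).le
          · exact hfC x
          · exact h ε hε x
      _ = _ := by ring
  · filter_upwards [hlim] with x hx
    have h1 := (Complex.continuous_ofReal.tendsto _).comp hx
    have h2 := (Complex.continuous_ofReal.tendsto _).comp (tendsto_regWeight hκ x)
    simpa using h1.mul (h2.const_mul (f x))

lemma integral_linMul (hR : IsReducedRootSystem R) (hRp : IsPositiveSystem R Rp)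
    (hκ : IsMultiplicity R κ) {n : ℕ} {f : Space d → ℂ} (hf : f ∈ homPoly d n) (ξ : Space d) :
    ∫ x, linMul ξ f x * (gaussWeight Rp κ x : ℂ) =
      ∫ x, dunklOp Rp κ ξ f x * (gaussWeight Rp κ x : ℂ) := by
  have hκ0 : ∀ α ∈ Rp, 0 ≤ κ α := fun α hα => hκ.nonneg α (hRp.mem hα)
  have hone : ∀ {n : ℕ} {f : Space d → ℂ}, f ∈ homPoly d n →
      Filter.Tendsto (fun ε => ∫ x, f x * (regWeight Rp κ ε x : ℂ))
        (nhdsWithin 0 (Set.Ioi 0)) (nhds (∫ x, f x * (gaussWeight Rp κ x : ℂ))) := by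
    intro n f hf
    have := tendsto_integral_regWeight hκ0 hf (fun _ _ => 1) (fun _ _ => continuous_const) (by simp)
      (Filter.Eventually.of_forall fun _ => tendsto_const_nhds)
    simpa using this
  have hα0 : ∀ α ∈ Rp, α ≠ 0 := fun α hα => hR.ne_zero α (hRp.mem hα)
  have hq : ∀ α ∈ Rp, Filter.Tendsto (fun ε => ∫ x, (regFactor α ε x : ℂ) *
      (diffQuot α f x * (regWeight Rp κ ε x : ℂ))) (nhdsWithin 0 (Set.Ioi 0))
      (nhds (∫ x, diffQuot α f x * (gaussWeight Rp κ x : ℂ))) := by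
    intro α hα
    refine tendsto_integral_regWeight hκ0 (diffQuot_mem (hα0 α hα) hf) (regFactor α)
      (fun ε hε => continuous_regFactor hε α) (fun ε hε x => ?_) ?_
    · have := regFactor_mem hε α x
      exact abs_le.2 ⟨by linarith, this.2⟩
    · filter_upwards [ae_inner_ne_zero (hα0 α hα)] with x hx
      have hc : ContinuousAt (fun ε : ℝ => ⟪α, x⟫ ^ 2 / (⟪α, x⟫ ^ 2 + ε)) 0 :=
        ContinuousAt.div (by fun_prop) (by fun_prop) (by positivity)
      have := hc.tendsto.mono_left (nhdsWithin_le_nhds (s := Set.Ioi 0))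
      simpa [hx, regFactor] using this
  have h1 := (hone (fderiv_mem ξ hf)).add (tendsto_finsetSum Rp fun α hα =>
    (hq α hα).const_mul (((κ α * ⟪α, ξ⟫ : ℝ) : ℂ)))
  have h2 := hone (linMul_mem ξ hf)
  have h3 := tendsto_nhds_unique_of_eventuallyEq h1 h2 (by
    filter_upwards [Ioc_mem_nhdsGT (zero_lt_one (α := ℝ))] with ε hε
    exact integral_regWeight_parts hR hRp hκ hε hf ξ)
  have hi : ∀ α ∈ Rp, Integrable fun x => ((κ α * ⟪α, ξ⟫ : ℝ) : ℂ) *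
      (diffQuot α f x * (gaussWeight Rp κ x : ℂ)) := fun α hα =>
    (integrable_gaussWeight hκ0 (diffQuot_mem (hα0 α hα) hf)).const_mul _
  rw [← h3]
  simp only [← integral_const_mul]
  rw [← integral_finsetSum _ hi, ← integral_add (integrable_gaussWeight hκ0 (fderiv_mem ξ hf))
    (integrable_finsetSum _ hi)]
  congr 1
  ext x
  simp only [dunklOp, add_mul, Finset.sum_mul, mul_assoc]

/-! ### The Gaussian mean -/

variable (Rp κ) in
/-- The mean of `f` with respect to the normalized weight `b_κ h_κ²(x) e^{-‖x‖²/2}`. -/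
def mean (f : Space d → ℂ) : ℂ := (bConst Rp κ : ℂ) * ∫ x, f x * (gaussWeight Rp κ x : ℂ)

lemma mean_add (hκ : ∀ α ∈ Rp, 0 ≤ κ α) {m n : ℕ} {f g : Space d → ℂ} (hf : f ∈ homPoly d m)
    (hg : g ∈ homPoly d n) : mean Rp κ (f + g) = mean Rp κ f + mean Rp κ g := by
  unfold mean
  rw [← mul_add, ← integral_add (integrable_gaussWeight hκ hf) (integrable_gaussWeight hκ hg)]
  simp only [Pi.add_apply, add_mul]

lemma mean_smul (c : ℂ) (f : Space d → ℂ) : mean Rp κ (c • f) = c * mean Rp κ f := by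
  unfold mean
  simp only [Pi.smul_apply, smul_eq_mul, mul_assoc, integral_const_mul]
  ring

lemma mean_zero : mean Rp κ (0 : Space d → ℂ) = 0 := by
  simp [mean]

lemma mean_sum (hκ : ∀ α ∈ Rp, 0 ≤ κ α) {ι : Type*} (s : Finset ι) {n : ℕ} (f : ι → Space d → ℂ)
    (hf : ∀ i ∈ s, f i ∈ homPoly d n) :
    mean Rp κ (∑ i ∈ s, f i) = ∑ i ∈ s, mean Rp κ (f i) := by
  classical
  induction s using Finset.induction_on with
  | empty => simp [mean_zero]
  | insert a s ha ih =>
    have hs : ∀ i ∈ s, f i ∈ homPoly d n := fun i hi => hf i (Finset.mem_insert_of_mem hi)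
    rw [Finset.sum_insert ha, Finset.sum_insert ha, mean_add hκ (hf a (Finset.mem_insert_self a s))
      (Submodule.sum_mem _ hs), ih hs]

lemma mean_comp_refl (hR : IsReducedRootSystem R) (hRp : IsPositiveSystem R Rp)
    (hκ : IsMultiplicity R κ) {β : Space d} (hβ : β ∈ R) (f : Space d → ℂ) :
    mean Rp κ (f ∘ refl β) = mean Rp κ f := by
  unfold mean
  rw [← integral_comp_refl β fun x => f x * (gaussWeight Rp κ x : ℂ)]
  simp only [gaussWeight_refl hR hRp hκ hβ, Function.comp]

lemma mean_linMul (hR : IsReducedRootSystem R) (hRp : IsPositiveSystem R Rp)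
    (hκ : IsMultiplicity R κ) {n : ℕ} {f : Space d → ℂ} (hf : f ∈ homPoly d n) (ξ : Space d) :
    mean Rp κ (linMul ξ f) = mean Rp κ (dunklOp Rp κ ξ f) := by
  unfold mean
  rw [integral_linMul hR hRp hκ hf]

lemma diffQuot_mul (α : Space d) {f g : Space d → ℂ} {x : Space d}
    (hf : DifferentiableAt ℝ f x) (hg : DifferentiableAt ℝ g x) :
    diffQuot α (fun x => f x * g x) x = diffQuot α f x * g x + f x * diffQuot α g x -
      ((⟪α, x⟫ : ℝ) : ℂ) * (diffQuot α f x * diffQuot α g x) := by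
  by_cases h : ⟪α, x⟫ = 0
  · simp only [diffQuot, h, if_true, Complex.ofReal_zero, zero_mul, sub_zero]
    rw [fderiv_fun_mul hf hg]
    simp only [add_apply, smul_apply, smul_eq_mul]
    ring
  · have h' : ((⟪α, x⟫ : ℝ) : ℂ) ≠ 0 := by exact_mod_cast h
    refine mul_left_cancel₀ h' ?_
    have e1 := inner_mul_diffQuot α (fun x => f x * g x) x
    have e2 := inner_mul_diffQuot α f x
    have e3 := inner_mul_diffQuot α g x
    linear_combination e1 - g x * e2 - f x * e3 +
      ((⟪α, x⟫ : ℝ) : ℂ) * diffQuot α g x * e2 + (f x - f (refl α x)) * e3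

lemma diffQuot_refl (α : Space d) (f : Space d → ℂ) (x : Space d) :
    diffQuot α f (refl α x) = diffQuot α f x := by
  by_cases h : ⟪α, x⟫ = 0
  · rw [refl_eq_self h]
  · have h2 : ¬ -⟪α, x⟫ = 0 := by simpa using h
    rw [diffQuot, diffQuot, inner_self_refl, if_neg h, if_neg h2, refl_refl, Complex.ofReal_neg,
      div_neg, ← neg_div, neg_sub]

lemma mean_eq_zero_of_odd (hR : IsReducedRootSystem R) (hRp : IsPositiveSystem R Rp)
    (hκ : IsMultiplicity R κ) {β : Space d} (hβ : β ∈ R) {f : Space d → ℂ}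
    (hf : f ∘ refl β = -f) : mean Rp κ f = 0 := by
  have h := mean_comp_refl hR hRp hκ hβ f
  have h' := mean_smul (Rp := Rp) (κ := κ) (-1) f
  rw [hf] at h
  rw [neg_one_smul, h] at h'
  linear_combination h' / 2

lemma mean_linMul_mul (hR : IsReducedRootSystem R) (hRp : IsPositiveSystem R Rp)
    (hκ : IsMultiplicity R κ) {m n : ℕ} {f g : Space d → ℂ} (hf : f ∈ homPoly d m)
    (hg : g ∈ homPoly d n) (ξ : Space d) :
    mean Rp κ (fun x => linMul ξ f x * g x) =
      mean Rp κ (fun x => dunklOp Rp κ ξ f x * g x) +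
      mean Rp κ (fun x => f x * dunklOp Rp κ ξ g x) := by
  have hκ0 : ∀ α ∈ Rp, 0 ≤ κ α := fun α hα => hκ.nonneg α (hRp.mem hα)
  have hα0 : ∀ α ∈ Rp, α ≠ 0 := fun α hα => hR.ne_zero α (hRp.mem hα)
  have e : (fun x => linMul ξ f x * g x) = linMul ξ fun x => f x * g x := by
    ext x
    simp only [linMul, mul_assoc]
  set u : Space d → Space d → ℂ := fun α => linMul α fun x => diffQuot α f x * diffQuot α g x
  have hu : ∀ α ∈ Rp, (((κ α * ⟪α, ξ⟫ : ℝ) : ℂ)) • u α ∈ homPoly d (m - 1 + (n - 1) + 1) :=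
    fun α hα => Submodule.smul_mem _ _ (linMul_mem _ (mul_mem (diffQuot_mem (hα0 α hα) hf)
      (diffQuot_mem (hα0 α hα) hg)))
  have h1 := mul_mem (dunklOp_mem (Rp := Rp) (κ := κ) ξ hf) hg
  have h2 := mul_mem hf (dunklOp_mem (Rp := Rp) (κ := κ) ξ hg)
  have h3 := dunklOp_mem (Rp := Rp) (κ := κ) ξ (mul_mem hf hg)
  have expand : dunklOp Rp κ ξ (fun x => f x * g x) +
      ∑ α ∈ Rp, (((κ α * ⟪α, ξ⟫ : ℝ) : ℂ)) • u α =
      (fun x => dunklOp Rp κ ξ f x * g x) + fun x => f x * dunklOp Rp κ ξ g x := by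
    ext x
    have hfx := differentiable_of_mem hf x
    have hgx := differentiable_of_mem hg x
    simp only [dunklOp, Pi.add_apply, Finset.sum_apply, Pi.smul_apply, smul_eq_mul, u, linMul,
      diffQuot_mul _ hfx hgx, fderiv_fun_mul hfx hgx, add_apply, smul_apply, mul_add, add_mul,
      Finset.sum_mul, Finset.mul_sum, mul_sub, Finset.sum_sub_distrib, Finset.sum_add_distrib]
    have e1 : ∑ α ∈ Rp, ((κ α * ⟪α, ξ⟫ : ℝ) : ℂ) * (diffQuot α f x * g x) =
        ∑ α ∈ Rp, ((κ α * ⟪α, ξ⟫ : ℝ) : ℂ) * diffQuot α f x * g x :=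
      Finset.sum_congr rfl fun _ _ => by ring
    have e2 : ∑ α ∈ Rp, ((κ α * ⟪α, ξ⟫ : ℝ) : ℂ) * (f x * diffQuot α g x) =
        ∑ α ∈ Rp, f x * (((κ α * ⟪α, ξ⟫ : ℝ) : ℂ) * diffQuot α g x) :=
      Finset.sum_congr rfl fun _ _ => by ring
    rw [e1, e2]
    ring
  have hz : mean Rp κ (∑ α ∈ Rp, (((κ α * ⟪α, ξ⟫ : ℝ) : ℂ)) • u α) = 0 := by
    rw [mean_sum hκ0 _ _ hu]
    refine Finset.sum_eq_zero fun α hα => ?_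
    rw [mean_smul, mean_eq_zero_of_odd hR hRp hκ (hRp.mem hα), mul_zero]
    ext x
    simp only [u, linMul, Function.comp, diffQuot_refl, inner_self_refl, Pi.neg_apply,
      Complex.ofReal_neg, neg_mul]
  rw [e, mean_linMul hR hRp hκ (mul_mem hf hg), ← mean_add hκ0 h1 h2, ← expand,
    mean_add hκ0 h3 (Submodule.sum_mem _ hu), hz, add_zero]

lemma bConst_mul_integral (hRp : IsPositiveSystem R Rp) (hκ : ∀ α ∈ Rp, 0 ≤ κ α) :
    bConst Rp κ * ∫ x, gaussWeight Rp κ x = 1 := by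
  refine inv_mul_cancel₀ (ne_of_gt ?_)
  obtain ⟨K, N, -, hK⟩ := exists_gaussWeight_le hκ
  have hint : Integrable (gaussWeight Rp κ) := ((integrable_gaussBound N).const_mul K).mono'
    (continuous_gaussWeight hκ).aestronglyMeasurable
    (Filter.Eventually.of_forall fun x => by
      rw [Real.norm_of_nonneg (gaussWeight_nonneg x)]
      exact hK x)
  change 0 < ∫ x, gaussWeight Rp κ x
  rw [integral_pos_iff_support_of_nonneg gaussWeight_nonneg hint]
  refine (continuous_gaussWeight hκ).isOpen_support.measure_pos _ ?_
  obtain ⟨v, hv0, hv⟩ := hRp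
  refine ⟨v, ?_⟩
  rw [Function.mem_support, gaussWeight]
  have : 0 < weight Rp κ v := Finset.prod_pos fun α hα =>
    Real.rpow_pos_of_pos (abs_pos.2 (hv0 α ((hv α).1 hα).1)) _
  positivity

lemma mean_one (hRp : IsPositiveSystem R Rp) (hκ : ∀ α ∈ Rp, 0 ≤ κ α) :
    mean Rp κ (fun _ => 1) = 1 := by
  unfold mean
  simp only [one_mul]
  rw [integral_complex_ofReal, ← Complex.ofReal_mul, bConst_mul_integral hRp hκ, Complex.ofReal_one]

/-! ### Gaussian means of the components of the kernel -/

variable {l : Space d →L[ℝ] ℂ} {M : FormalMultilinearSeries ℝ (Space d) ℂ}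

lemma mean_formMul (hR : IsReducedRootSystem R) (hRp : IsPositiveSystem R Rp)
    (hκ : IsMultiplicity R κ) {n : ℕ} {f : Space d → ℂ} (hf : f ∈ homPoly d n) :
    mean Rp κ (formMul l f) = ∑ j, l (EuclideanSpace.single j (1 : ℝ)) *
      mean Rp κ (dunklD Rp κ j f) := by
  have hκ0 : ∀ α ∈ Rp, 0 ≤ κ α := fun α hα => hκ.nonneg α (hRp.mem hα)
  rw [formMul_eq_sum, mean_sum hκ0 _ _ fun j _ => Submodule.smul_mem _ _ (linMul_mem _ hf)]
  refine Finset.sum_congr rfl fun j _ => ?_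
  rw [mean_smul, mean_linMul hR hRp hκ hf, dunklD]

lemma IsKernelSeries.mean_comp_succ (hR : IsReducedRootSystem R) (hRp : IsPositiveSystem R Rp)
    (hκ : IsMultiplicity R κ) (hM : IsKernelSeries Rp κ l M) (n : ℕ) :
    ((n : ℂ) + 1) * mean Rp κ (comp M (n + 1)) = mean Rp κ (formMul l (comp M n)) := by
  have hκ0 : ∀ α ∈ Rp, 0 ≤ κ α := fun α hα => hκ.nonneg α (hRp.mem hα)
  have hEs := comp_mem M (n + 1)
  have hrel : ((n + 1 + gam Rp κ : ℝ) : ℂ) • comp M (n + 1) +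
      ∑ α ∈ Rp, (-(κ α : ℂ)) • (comp M (n + 1) ∘ refl α) = formMul l (comp M n) := by
    ext x
    have h := hM.comp_succ n x
    simp only [Pi.add_apply, Pi.smul_apply, Finset.sum_apply, smul_eq_mul, Function.comp,
      neg_mul, Finset.sum_neg_distrib, formMul]
    linear_combination h
  have hm : ∀ α ∈ Rp, (-(κ α : ℂ)) • (comp M (n + 1) ∘ refl α) ∈ homPoly d (n + 1) :=
    fun α _ => Submodule.smul_mem _ _ (comp_refl_mem α hEs)
  rw [← hrel, mean_add hκ0 (Submodule.smul_mem _ _ hEs) (Submodule.sum_mem _ hm),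
    mean_sum hκ0 _ _ hm, mean_smul]
  have e : ∀ α ∈ Rp, mean Rp κ ((-(κ α : ℂ)) • (comp M (n + 1) ∘ refl α)) =
      -(κ α : ℂ) * mean Rp κ (comp M (n + 1)) := by
    intro α hα
    rw [mean_smul, mean_comp_refl hR hRp hκ (hRp.mem hα)]
  rw [Finset.sum_congr rfl e, ← Finset.sum_mul, Finset.sum_neg_distrib, gam]
  push_cast
  ring

lemma IsKernelSeries.mean_comp_even (hR : IsReducedRootSystem R) (hRp : IsPositiveSystem R Rp)
    (hκ : IsMultiplicity R κ) (hM : IsKernelSeries Rp κ l M) (k : ℕ) :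
    mean Rp κ (comp M (2 * k)) = (∑ j, l (EuclideanSpace.single j (1 : ℝ)) ^ 2) ^ k /
      (2 ^ k * k.factorial) := by
  have hκ0 : ∀ α ∈ Rp, 0 ≤ κ α := fun α hα => hκ.nonneg α (hRp.mem hα)
  induction k with
  | zero => simp [hM.comp_zero, mean_one hRp hκ0]
  | succ k ih =>
    have h := hM.mean_comp_succ hR hRp hκ (2 * k + 1)
    rw [mean_formMul hR hRp hκ (comp_mem M _)] at h
    simp only [dunklD, hM.dunklOp_comp_succ hR hRp hκ, mean_smul, ih, ← mul_assoc] at h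
    rw [← Finset.sum_mul] at h
    rw [show 2 * (k + 1) = 2 * k + 1 + 1 by ring, eq_div_iff (mul_ne_zero (by simp) (by exact_mod_cast Nat.factorial_ne_zero _)),
      Nat.factorial_succ]
    simp only [← sq] at h
    set s := ∑ j, l (EuclideanSpace.single j (1 : ℝ)) ^ 2
    have h4 : s * (s ^ k / (2 ^ k * k.factorial)) * (2 ^ k * k.factorial) = s ^ (k + 1) := by
      rw [mul_assoc, div_mul_cancel₀ _ (mul_ne_zero (by simp)
        (by exact_mod_cast Nat.factorial_ne_zero _)), pow_succ']
    rw [← h4, ← h]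
    push_cast
    ring

lemma IsKernelSeries.mean_comp_odd (hR : IsReducedRootSystem R) (hRp : IsPositiveSystem R Rp)
    (hκ : IsMultiplicity R κ) (hM : IsKernelSeries Rp κ l M) (k : ℕ) :
    mean Rp κ (comp M (2 * k + 1)) = 0 := by
  induction k with
  | zero =>
    have h := hM.mean_comp_succ hR hRp hκ 0
    rw [mean_formMul hR hRp hκ (comp_mem M _)] at h
    simpa [dunklD, dunklOp_eq_zero_of_mem _ (comp_mem M 0), mean_zero] using h
  | succ k ih =>
    have h := hM.mean_comp_succ hR hRp hκ (2 * k + 2)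
    rw [mean_formMul hR hRp hκ (comp_mem M _)] at h
    simp only [dunklD, hM.dunklOp_comp_succ hR hRp hκ, mean_smul, ih, mul_zero,
      Finset.sum_const_zero, mul_eq_zero] at h
    refine h.resolve_left ?_
    exact_mod_cast Nat.succ_ne_zero (2 * k + 2)

end

section

variable {R Rp : Finset (Space d)} {κ : Space d → ℝ}

/-! ### Polar coordinates -/

lemma weight_smul {t : ℝ} (ht : 0 < t) (x : Space d) :
    weight Rp κ (t • x) = t ^ gam Rp κ * weight Rp κ x := by
  unfold weight gam
  rw [Real.rpow_sum_of_pos ht, ← Finset.prod_mul_distrib]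
  refine Finset.prod_congr rfl fun α _ => ?_
  rw [inner_smul_right, abs_mul, abs_of_pos ht, Real.mul_rpow ht.le (abs_nonneg _)]

/-- The coefficient `2^{-(ν + s/2)} / Γ(ν + s/2 + 1)`. -/
def besselCoeff (ν s : ℝ) : ℝ := 2 ^ (-(ν + s / 2)) / Real.Gamma (ν + s / 2 + 1)

lemma integral_radial (hd : 0 < d) (hκ : ∀ α ∈ Rp, 0 ≤ κ α) (n : ℕ) :
    ∫ r in Set.Ioi (0 : ℝ), r ^ (d - 1) * (r ^ n * ((r ^ gam Rp κ) ^ 2 * Real.exp (-r ^ 2 / 2))) =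
      2 ^ (lam Rp κ + n / 2) * Real.Gamma (lam Rp κ + n / 2 + 1) := by
  have hγ := gam_nonneg hκ
  have hd' : (1 : ℝ) ≤ d := by exact_mod_cast hd
  have hn : (0 : ℝ) ≤ n := n.cast_nonneg
  set q : ℝ := (d : ℝ) - 1 + n + 2 * gam Rp κ with hq
  have h := integral_rpow_mul_exp_neg_mul_rpow (p := 2) (q := q) (b := 1 / 2) (by norm_num)
    (by linarith) (by norm_num)
  have hs : (q + 1) / 2 = lam Rp κ + n / 2 + 1 := by
    rw [hq, lam]
    ring
  calc _ = ∫ r in Set.Ioi (0 : ℝ), r ^ q * Real.exp (-(1 / 2) * r ^ (2 : ℝ)) := by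
        refine setIntegral_congr_fun measurableSet_Ioi fun r hr => ?_
        have hr : 0 < r := hr
        have e : r ^ q = r ^ (d - 1) * r ^ n * (r ^ gam Rp κ) ^ 2 := by
          rw [hq, Real.rpow_add hr, Real.rpow_add hr, Real.rpow_natCast, mul_comm (2 : ℝ),
            Real.rpow_mul hr.le, Real.rpow_two, ← Real.rpow_natCast r (d - 1),
            Nat.cast_sub (show 1 ≤ d from hd), Nat.cast_one]
        simp only [e, Real.rpow_two]
        rw [show -(1 / 2) * r ^ 2 = -r ^ 2 / 2 by ring]
        ring
    _ = _ := by
        rw [h, neg_div, hs, one_div, Real.inv_rpow (by norm_num), ← Real.rpow_neg (by norm_num),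
          neg_neg, Real.rpow_add_one (by norm_num), mul_assoc _ (2 : ℝ), mul_inv_cancel₀ (by norm_num),
          mul_one]

lemma integral_gaussWeight_eq (hd : 0 < d) (hκ : ∀ α ∈ Rp, 0 ≤ κ α) {n : ℕ} {f : Space d → ℂ}
    (hf : f ∈ homPoly d n) : ∫ x, f x * (gaussWeight Rp κ x : ℂ) =
      (∫ x : Metric.sphere (0 : Space d) 1, f x * ((weight Rp κ x ^ 2 : ℝ) : ℂ)
        ∂(volume : Measure (Space d)).toSphere) *
      ((2 ^ (lam Rp κ + n / 2) * Real.Gamma (lam Rp κ + n / 2 + 1) : ℝ) : ℂ) := by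
  set H : ℝ → ℝ := fun r => r ^ n * ((r ^ gam Rp κ) ^ 2 * Real.exp (-r ^ 2 / 2)) with hH
  have hfin : Module.finrank ℝ (Space d) = d := by simp
  calc ∫ x, f x * (gaussWeight Rp κ x : ℂ)
      = ∫ x : ({(0 : Space d)}ᶜ : Set (Space d)), f x.1 * (gaussWeight Rp κ x.1 : ℂ)
          ∂((volume : Measure (Space d)).comap (↑)) := by
        have : Nontrivial (Space d) := by
          have : NeZero d := ⟨hd.ne'⟩
          infer_instance
        rw [integral_subtype_comap (measurableSet_singleton _).compl
          fun x => f x * (gaussWeight Rp κ x : ℂ), restrict_compl_singleton]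
    _ = ∫ z : Metric.sphere (0 : Space d) 1 × Set.Ioi (0 : ℝ),
          (f z.1 * ((weight Rp κ z.1 ^ 2 : ℝ) : ℂ)) * (H z.2 : ℂ)
          ∂(volume : Measure (Space d)).toSphere.prod
            (.volumeIoiPow (Module.finrank ℝ (Space d) - 1)) := by
        rw [← ((volume : Measure (Space d)).measurePreserving_homeomorphUnitSphereProd).integral_comp
          (Homeomorph.measurableEmbedding _)]
        refine integral_congr_ae (Filter.Eventually.of_forall fun x => ?_)
        have hx : 0 < ‖(x : Space d)‖ := norm_pos_iff.2 x.2
        have e : (x : Space d) = ‖(x : Space d)‖ • (‖(x : Space d)‖⁻¹ • (x : Space d)) := by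
          rw [smul_smul, mul_inv_cancel₀ hx.ne', one_smul]
        have e1 : f x = (‖(x : Space d)‖ : ℂ) ^ n * f (‖(x : Space d)‖⁻¹ • (x : Space d)) := by
          conv_lhs => rw [e, map_smul_of_mem hf]
        have e2 : weight Rp κ x = ‖(x : Space d)‖ ^ gam Rp κ *
            weight Rp κ (‖(x : Space d)‖⁻¹ • (x : Space d)) := by
          conv_lhs => rw [e, weight_smul hx]
        simp only [homeomorphUnitSphereProd_apply_fst_coe, homeomorphUnitSphereProd_apply_snd_coe]
        rw [e1, gaussWeight, e2, hH]
        push_cast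
        ring
    _ = (∫ x : Metric.sphere (0 : Space d) 1, f x * ((weight Rp κ x ^ 2 : ℝ) : ℂ)
          ∂(volume : Measure (Space d)).toSphere) *
        ∫ r : Set.Ioi (0 : ℝ), (H r : ℂ) ∂Measure.volumeIoiPow (Module.finrank ℝ (Space d) - 1) :=
        integral_prod_mul (fun x : Metric.sphere (0 : Space d) 1 =>
          f x * ((weight Rp κ x ^ 2 : ℝ) : ℂ)) fun r : Set.Ioi (0 : ℝ) => (H r : ℂ)
    _ = _ := by
        congr 1
        rw [integral_complex_ofReal, hfin, ← integral_radial hd hκ n]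
        congr 1
        simp only [Measure.volumeIoiPow, ENNReal.ofReal]
        rw [integral_withDensity_eq_integral_smul,
          integral_subtype_comap measurableSet_Ioi fun a => Real.toNNReal (a ^ (d - 1)) • H a,
          setIntegral_congr_fun measurableSet_Ioi fun x hx => ?_]
        · rw [NNReal.smul_def, Real.coe_toNNReal _ (pow_nonneg hx.out.le _)]
          rfl
        · exact (measurable_subtype_coe.pow_const _).real_toNNReal

lemma neg_half_le_lam (hd : 0 < d) (hκ : ∀ α ∈ Rp, 0 ≤ κ α) : -(1 / 2) ≤ lam Rp κ := by
  have hγ := gam_nonneg hκ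
  have hd' : (1 : ℝ) ≤ d := by exact_mod_cast hd
  rw [lam]
  linarith

lemma sphere_mean_eq (hd : 0 < d) (hκ : ∀ α ∈ Rp, 0 ≤ κ α) {n : ℕ} {f : Space d → ℂ}
    (hf : f ∈ homPoly d n) :
    (bConst Rp κ : ℂ) * ∫ x : Metric.sphere (0 : Space d) 1, f x * ((weight Rp κ x ^ 2 : ℝ) : ℂ)
      ∂(volume : Measure (Space d)).toSphere =
      mean Rp κ f * (besselCoeff (lam Rp κ) n : ℂ) := by
  have hl := neg_half_le_lam hd hκ
  have hn : (0 : ℝ) ≤ n := n.cast_nonneg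
  have hG : Real.Gamma (lam Rp κ + n / 2 + 1) ≠ 0 := (Real.Gamma_pos_of_pos (by linarith)).ne'
  have e : (2 ^ (lam Rp κ + n / 2) * Real.Gamma (lam Rp κ + n / 2 + 1)) *
      besselCoeff (lam Rp κ) n = 1 := by
    have h2 : (2 : ℝ) ^ (lam Rp κ + n / 2) ≠ 0 := (Real.rpow_pos_of_pos (by norm_num) _).ne'
    rw [besselCoeff, Real.rpow_neg (by norm_num)]
    generalize (2 : ℝ) ^ (lam Rp κ + n / 2) = A at h2 ⊢
    generalize Real.Gamma (lam Rp κ + n / 2 + 1) = G at hG ⊢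
    field_simp
  rw [mean, integral_gaussWeight_eq hd hκ hf, mul_assoc, mul_assoc, ← Complex.ofReal_mul, e,
    Complex.ofReal_one, mul_one]

/-! ### The Bessel series -/

lemma Gamma_lower_bound {ν : ℝ} (hν : -(1 / 2) ≤ ν) (k : ℕ) :
    Real.Gamma (ν + 1) * (1 / 2) ^ k ≤ Real.Gamma (ν + k + 1) := by
  induction k with
  | zero => simp
  | succ k ih =>
    have hk : (0 : ℝ) ≤ k := k.cast_nonneg
    have hp : 0 < Real.Gamma (ν + k + 1) := Real.Gamma_pos_of_pos (by linarith)
    rw [show ν + ((k + 1 : ℕ) : ℝ) + 1 = (ν + k + 1) + 1 by push_cast; ring,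
      Real.Gamma_add_one (s := ν + k + 1) (by linarith : 0 < ν + k + 1).ne', pow_succ, ← mul_assoc,
      mul_comm _ (1 / 2 : ℝ)]
    exact mul_le_mul (by linarith) ih (by have := Real.Gamma_pos_of_pos (s := ν + 1) (by linarith)
                                          positivity) (by linarith)

lemma summable_besselQuot {ν : ℝ} (hν : -(1 / 2) ≤ ν) (r : ℝ) :
    Summable fun k : ℕ => (-r ^ 2) ^ k / (2 ^ k * (k.factorial : ℝ)) * besselCoeff ν (2 * k) := by
  have hΓ : 0 < Real.Gamma (ν + 1) := Real.Gamma_pos_of_pos (by linarith)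
  refine Summable.of_norm_bounded ((Real.summable_pow_div_factorial (r ^ 2 / 2)).mul_left
    (2 ^ (-ν) / Real.Gamma (ν + 1))) fun k => ?_
  have hk : (0 : ℝ) ≤ k := k.cast_nonneg
  have hp : 0 < Real.Gamma (ν + k + 1) := Real.Gamma_pos_of_pos (by linarith)
  have hb := Gamma_lower_bound hν k
  have h1 : besselCoeff ν (2 * k) ≤ 2 ^ (-ν) / Real.Gamma (ν + 1) := by
    rw [besselCoeff, mul_div_cancel_left₀ _ (two_ne_zero), neg_add, Real.rpow_add (by norm_num),
      Real.rpow_neg (by norm_num) (k : ℝ), Real.rpow_natCast, div_le_div_iff₀ hp hΓ, mul_assoc]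
    refine mul_le_mul_of_nonneg_left ?_ (by positivity)
    rw [← inv_pow, mul_comm]
    simpa using hb
  have h0 : 0 ≤ besselCoeff ν (2 * k) := by
    rw [besselCoeff, mul_div_cancel_left₀ _ (two_ne_zero)]
    positivity
  have e : ‖(-r ^ 2) ^ k / (2 ^ k * (k.factorial : ℝ))‖ = (r ^ 2 / 2) ^ k / k.factorial := by
    rw [norm_div, norm_pow, norm_neg, Real.norm_of_nonneg (sq_nonneg r),
      Real.norm_of_nonneg (by positivity), div_pow, div_div]
  rw [norm_mul, e, Real.norm_of_nonneg h0, mul_comm]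
  gcongr

lemma hasSum_besselQuot {ν : ℝ} (hν : -(1 / 2) ≤ ν) {r : ℝ} (hr : 0 ≤ r) :
    HasSum (fun k : ℕ => (-r ^ 2) ^ k / (2 ^ k * (k.factorial : ℝ)) * besselCoeff ν (2 * k))
      (besselQuot ν r) := by
  have hc : ∀ k : ℕ, besselCoeff ν (2 * k) = 2 ^ (-ν) / 2 ^ k / Real.Gamma (ν + k + 1) := by
    intro k
    rw [besselCoeff, mul_div_cancel_left₀ _ (two_ne_zero), neg_add, Real.rpow_add (by norm_num),
      Real.rpow_neg (by norm_num) (k : ℝ), Real.rpow_natCast]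
    rfl
  rw [besselQuot]
  split_ifs with h
  · convert! hasSum_single (α := ℝ) 0 fun k hk => ?_ using 1
    · have := hc 0
      simp only [Nat.cast_zero, pow_zero, div_one, add_zero] at this
      simp only [pow_zero, Nat.factorial_zero, Nat.cast_one, mul_one, div_one, Nat.cast_zero,
        one_mul, this]
      rw [Real.rpow_neg (by norm_num)]
      field_simp
    · simp [h, hk]
  · have hr' : 0 < r := lt_of_le_of_ne hr (Ne.symm h)
    convert! (summable_besselQuot hν r).hasSum using 1
    rw [besselJ, ← tsum_div_const]
    refine tsum_congr fun k => ?_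
    have hrν : r ^ ν ≠ 0 := (Real.rpow_pos_of_pos hr' ν).ne'
    have e : (r / 2) ^ (ν + 2 * (k : ℝ)) = r ^ ν * 2 ^ (-ν) * (r ^ 2 / 4) ^ k := by
      rw [Real.rpow_add (by positivity), Real.rpow_mul (by positivity), Real.rpow_natCast,
        Real.div_rpow hr (by norm_num), Real.rpow_neg (by norm_num), Real.rpow_two, div_pow, div_eq_mul_inv (r ^ ν)]
      norm_num
    rw [hc, e, neg_pow (r ^ 2), div_pow, show (4 : ℝ) = 2 * 2 by norm_num, mul_pow]
    have hG : Real.Gamma (ν + k + 1) ≠ 0 := by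
      have hk : (0 : ℝ) ≤ k := k.cast_nonneg
      exact (Real.Gamma_pos_of_pos (by linarith)).ne'
    generalize Real.Gamma (ν + k + 1) = G at hG ⊢
    generalize (2 : ℝ) ^ (-ν) = A
    generalize r ^ ν = B at hrν ⊢
    field_simp

/-! ### Series expansion of the transform -/

lemma coordForm_negI (y ζ : Space d) :
    coordForm (negI y) ζ = -Complex.I * ((⟪ζ, y⟫ : ℝ) : ℂ) := by
  rw [coordForm_apply, PiLp.inner_apply]
  push_cast
  rw [Finset.mul_sum]
  refine Finset.sum_congr rfl fun j _ => ?_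
  simp [negI]
  ring

lemma sum_coordForm_negI_sq (y : Space d) :
    ∑ j, coordForm (negI y) (EuclideanSpace.single j (1 : ℝ)) ^ 2 = ((-‖y‖ ^ 2 : ℝ) : ℂ) := by
  simp only [coordForm_single, negI]
  rw [EuclideanSpace.real_norm_sq_eq]
  push_cast
  rw [← Finset.sum_neg_distrib]
  refine Finset.sum_congr rfl fun j _ => ?_
  rw [mul_pow, neg_sq, Complex.I_sq, neg_one_mul]

variable (Rp κ) in
/-- The right-hand side of the Funk–Hecke type formula, with a shifted Bessel index. -/
def besselSum (y : Space d) (ν : ℝ) (m : ℕ) (f : Space d → ℂ) : ℂ :=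
  (-Complex.I) ^ m * ∑ j ∈ Finset.range (m + 1), (-1) ^ j / (2 ^ j * (j.factorial : ℂ)) *
    (besselQuot (ν + m - j) ‖y‖ : ℂ) * ((dunklLaplacian Rp κ)^[j] f) y

lemma besselSum_zero (y : Space d) (ν : ℝ) (m : ℕ) : besselSum Rp κ y ν m 0 = 0 := by
  simp [besselSum, dunklLaplacian_iterate_zero]

lemma besselSum_add (y : Space d) (ν : ℝ) {m : ℕ} {f g : Space d → ℂ} (hf : f ∈ homPoly d m)
    (hg : g ∈ homPoly d m) :
    besselSum Rp κ y ν m (f + g) = besselSum Rp κ y ν m f + besselSum Rp κ y ν m g := by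
  simp only [besselSum, dunklLaplacian_iterate_add hf hg, Pi.add_apply, mul_add,
    Finset.sum_add_distrib]

lemma besselSum_smul (y : Space d) (ν : ℝ) {m : ℕ} (c : ℂ) {f : Space d → ℂ}
    (hf : f ∈ homPoly d m) :
    besselSum Rp κ y ν m (c • f) = c * besselSum Rp κ y ν m f := by
  simp only [besselSum, dunklLaplacian_iterate_smul c hf, Pi.smul_apply, Finset.mul_sum,
    smul_eq_mul]
  exact Finset.sum_congr rfl fun _ _ => by ring

lemma besselSum_linMul (hR : IsReducedRootSystem R) (hRp : IsPositiveSystem R Rp)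
    (hκ : IsMultiplicity R κ) (y ζ : Space d) (ν : ℝ) {m : ℕ} {f : Space d → ℂ}
    (hf : f ∈ homPoly d m) : besselSum Rp κ y ν (m + 1) (linMul ζ f) =
      besselSum Rp κ y (ν + 1) (m - 1) (dunklOp Rp κ ζ f) +
        coordForm (negI y) ζ * besselSum Rp κ y (ν + 1) m f := by
  have hfirst : ∑ j ∈ Finset.range (m + 1 + 1), (-1) ^ j / (2 ^ j * (j.factorial : ℂ)) *
      (besselQuot (ν + (m + 1 : ℕ) - j) ‖y‖ : ℂ) *
        (linMul ζ ((dunklLaplacian Rp κ)^[j] f)) y =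
      ((⟪ζ, y⟫ : ℝ) : ℂ) * ∑ j ∈ Finset.range (m + 1), (-1) ^ j / (2 ^ j * (j.factorial : ℂ)) *
      (besselQuot (ν + 1 + m - j) ‖y‖ : ℂ) * ((dunklLaplacian Rp κ)^[j] f) y := by
    rw [Finset.sum_range_succ, dunklLaplacian_iterate_eq_zero (by omega) hf, Finset.mul_sum]
    simp only [linMul, Pi.zero_apply, mul_zero, add_zero]
    refine Finset.sum_congr rfl fun j _ => ?_
    rw [show ν + ((m + 1 : ℕ) : ℝ) - j = ν + 1 + m - j by push_cast; ring]
    ring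
  have hsplit : ∑ j ∈ Finset.range (m + 1 + 1), (-1) ^ j / (2 ^ j * (j.factorial : ℂ)) *
      (besselQuot (ν + (m + 1 : ℕ) - j) ‖y‖ : ℂ) *
        ((dunklLaplacian Rp κ)^[j] (linMul ζ f)) y =
      ∑ j ∈ Finset.range (m + 1 + 1), (-1) ^ j / (2 ^ j * (j.factorial : ℂ)) *
      (besselQuot (ν + (m + 1 : ℕ) - j) ‖y‖ : ℂ) *
        (linMul ζ ((dunklLaplacian Rp κ)^[j] f)) y -
      ∑ j ∈ Finset.range (m + 1), (-1) ^ j / (2 ^ j * (j.factorial : ℂ)) *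
      (besselQuot (ν + m - j) ‖y‖ : ℂ) * ((dunklLaplacian Rp κ)^[j] (dunklOp Rp κ ζ f)) y := by
    rw [Finset.sum_range_succ', Finset.sum_range_succ' (n := m + 1)]
    simp only [Function.iterate_zero, id_eq]
    refine (congrArg (· + _) ?_).trans (sub_add_eq_add_sub _ _ _)
    rw [← Finset.sum_sub_distrib]
    refine Finset.sum_congr rfl fun j _ => ?_
    rw [dunklLaplacian_iterate_linMul hR hRp hκ ζ hf,
      show ν + ((m + 1 : ℕ) : ℝ) - ((j + 1 : ℕ) : ℝ) = ν + m - j by push_cast; ring,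
      Nat.factorial_succ, Pi.add_apply, Pi.smul_apply, smul_eq_mul]
    have h1 : (j.factorial : ℂ) ≠ 0 := by exact_mod_cast j.factorial_ne_zero
    have h2 : (j : ℂ) + 1 ≠ 0 := by exact_mod_cast j.succ_ne_zero
    push_cast
    field_simp
    ring
  have hsecond : (-Complex.I) ^ (m + 1) * -∑ j ∈ Finset.range (m + 1),
      (-1) ^ j / (2 ^ j * (j.factorial : ℂ)) * (besselQuot (ν + m - j) ‖y‖ : ℂ) *
        ((dunklLaplacian Rp κ)^[j] (dunklOp Rp κ ζ f)) y =
      besselSum Rp κ y (ν + 1) (m - 1) (dunklOp Rp κ ζ f) := by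
    rcases m with _ | m
    · simp [dunklOp_eq_zero_of_mem ζ hf, besselSum_zero, dunklLaplacian_iterate_zero]
    · have hD := dunklOp_mem (Rp := Rp) (κ := κ) ζ hf
      rw [Nat.add_sub_cancel] at hD
      rw [Finset.sum_range_succ, dunklLaplacian_iterate_eq_zero (by omega) hD, Pi.zero_apply,
        mul_zero, add_zero, besselSum, Nat.add_sub_cancel, pow_succ, pow_succ,
        mul_assoc _ (-Complex.I) (-Complex.I), neg_mul_neg, Complex.I_mul_I, mul_assoc,
        neg_one_mul, neg_neg]
      congr 1
      refine Finset.sum_congr rfl fun j _ => ?_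
      rw [show ν + ((m + 1 : ℕ) : ℝ) - j = ν + 1 + m - j by push_cast; ring]
  rw [← hsecond, besselSum, besselSum, hsplit, hfirst, coordForm_negI]
  ring

lemma besselCoeff_shift {ν ν' s s' : ℝ} (h : ν + s / 2 = ν' + s' / 2) :
    besselCoeff ν s = besselCoeff ν' s' := by
  rw [besselCoeff, besselCoeff, h]

variable {M : FormalMultilinearSeries ℝ (Space d) ℂ}

lemma hasSum_mean (hR : IsReducedRootSystem R) (hRp : IsPositiveSystem R Rp)
    (hκ : IsMultiplicity R κ) {y : Space d} (hM : IsKernelSeries Rp κ (coordForm (negI y)) M)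
    {m : ℕ} {f : Space d → ℂ} (hf : f ∈ homPoly d m) {ν : ℝ} (hν : -(1 / 2) ≤ ν) :
    HasSum (fun n : ℕ => mean Rp κ (fun x => f x * comp M n x) * (besselCoeff ν (m + n) : ℂ))
      (besselSum Rp κ y ν m f) := by
  have hκ0 : ∀ α ∈ Rp, 0 ≤ κ α := fun α hα => hκ.nonneg α (hRp.mem hα)
  induction m using Nat.strong_induction_on generalizing f ν with
  | _ m ih =>
  rcases m with _ | m
  · obtain ⟨c, rfl⟩ := Submodule.mem_span_singleton.1 hf
    have hb := ((hasSum_besselQuot hν (norm_nonneg y)).mapL Complex.ofRealCLM).mul_left c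
    have hval : besselSum Rp κ y ν 0 (c • fun _ => 1) = c * Complex.ofRealCLM (besselQuot ν ‖y‖) := by
      simp [besselSum, mul_comm]
    have hmean : ∀ n, mean Rp κ (fun x => (c • fun _ => (1 : ℂ)) x * comp M n x) =
        c * mean Rp κ (comp M n) := by
      intro n
      rw [← mean_smul]
      congr 1
      ext x
      simp
    rw [hval, ← add_zero (c * _)]
    refine HasSum.even_add_odd ?_ ?_
    · convert! hb using 2 with k
      rw [hmean, hM.mean_comp_even hR hRp hκ, sum_coordForm_negI_sq]
      simp only [Complex.ofRealCLM_apply]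
      push_cast
      rw [zero_add]
      ring
    · simp only [hmean, hM.mean_comp_odd hR hRp hκ, mul_zero, zero_mul]
      exact hasSum_zero
  · refine homPoly_succ_induction (motive := fun f => HasSum (fun n : ℕ =>
      mean Rp κ (fun x => f x * comp M n x) * (besselCoeff ν ((m + 1 : ℕ) + n) : ℂ))
      (besselSum Rp κ y ν (m + 1) f)) ?_ ?_ ?_ ?_ hf
    · intro ζ f hf
      rw [besselSum_linMul hR hRp hκ y ζ ν hf]
      simp only [mean_linMul_mul hR hRp hκ hf (comp_mem M _), add_mul]
      refine HasSum.add ?_ ?_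
      · rcases m with _ | m
        · simp only [dunklOp_eq_zero_of_mem ζ hf, besselSum_zero, Pi.zero_apply, zero_mul]
          have : mean Rp κ (fun _ : Space d => 0) = 0 := mean_zero
          simp only [this, zero_mul]
          exact hasSum_zero
        · have hD := dunklOp_mem (Rp := Rp) (κ := κ) ζ hf
          rw [Nat.add_sub_cancel] at hD ⊢
          have e : ∀ n : ℕ, besselCoeff ν ((m + 1 + 1 : ℕ) + n) =
              besselCoeff (ν + 1) (m + n) := fun n => besselCoeff_shift (by push_cast; ring)
          simp only [e]
          exact ih m (by omega) hD (by linarith)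
      · refine (hasSum_nat_add_iff' (f := fun n : ℕ => mean Rp κ (fun x => f x *
          dunklOp Rp κ ζ (comp M n) x) * (besselCoeff ν ((m + 1 : ℕ) + n) : ℂ)) 1).1 ?_
        have h0 : dunklOp Rp κ ζ (comp M 0) = 0 := dunklOp_eq_zero_of_mem ζ (comp_mem M 0)
        have hz : mean Rp κ (fun _ : Space d => 0) = 0 := mean_zero
        simp only [Finset.sum_range_one, h0, Pi.zero_apply, mul_zero, hz, zero_mul, sub_zero]
        have h := (ih m (by omega) hf (ν := ν + 1) (by linarith)).mul_left (coordForm (negI y) ζ)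
        convert! h using 2 with n
        rw [hM.dunklOp_comp_succ hR hRp hκ, ← mul_assoc, ← mean_smul]
        congr 2
        · ext x
          simp only [Pi.smul_apply, smul_eq_mul]
          ring
        · apply besselCoeff_shift
          push_cast
          ring
    · rw [besselSum_zero]
      simp only [Pi.zero_apply, zero_mul]
      have hz : mean Rp κ (fun _ : Space d => 0) = 0 := mean_zero
      simp only [hz, zero_mul]
      exact hasSum_zero
    · intro f g hf hg h₁ h₂
      rw [besselSum_add y ν hf hg]
      convert! h₁.add h₂ using 2 with n
      rw [← add_mul, ← mean_add hκ0 (mul_mem hf (comp_mem M n)) (mul_mem hg (comp_mem M n))]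
      congr 2
      ext x
      simp only [Pi.add_apply, add_mul]
    · intro c f hf h
      rw [besselSum_smul y ν c hf]
      convert! h.mul_left c using 2 with n
      rw [← mul_assoc, ← mean_smul]
      congr 2
      ext x
      simp only [Pi.smul_apply, smul_eq_mul, mul_assoc]

lemma hasSum_sphere_integral {l : Space d →L[ℝ] ℂ} (hM : IsKernelSeries Rp κ l M)
    (hκ : ∀ α ∈ Rp, 0 ≤ κ α) {f : Space d → ℂ} (hf : Continuous f) :
    HasSum (fun n : ℕ => ∫ x : Metric.sphere (0 : Space d) 1,
      (f x * comp M n x) * ((weight Rp κ x ^ 2 : ℝ) : ℂ) ∂(volume : Measure (Space d)).toSphere)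
      (∫ x : Metric.sphere (0 : Space d) 1, f x * M.sum x * ((weight Rp κ x ^ 2 : ℝ) : ℂ)
        ∂(volume : Measure (Space d)).toSphere) := by
  have hw : Continuous fun x => ((weight Rp κ x ^ 2 : ℝ) : ℂ) :=
    Complex.continuous_ofReal.comp ((continuous_weight hκ).pow 2)
  obtain ⟨C, hC⟩ := (isCompact_sphere (0 : Space d) 1).exists_bound_of_continuousOn
    (hf.mul hw).continuousOn
  have hcont : ∀ n, Continuous fun x : Metric.sphere (0 : Space d) 1 =>
      (f x * comp M n x) * ((weight Rp κ x ^ 2 : ℝ) : ℂ) := fun n =>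
    ((hf.mul (continuous_of_mem (comp_mem M n))).mul hw).comp continuous_subtype_val
  have hb : ∀ n (x : Metric.sphere (0 : Space d) 1),
      ‖(f x * comp M n x) * ((weight Rp κ x ^ 2 : ℝ) : ℂ)‖ ≤ C * (‖l‖ ^ n / n.factorial) := by
    intro n x
    have hx : ‖(x : Space d)‖ = 1 := by simp
    have h1 := hM.norm_comp_le n x
    rw [hx, mul_one] at h1
    rw [mul_right_comm, norm_mul]
    have h2 : ‖f x * ((weight Rp κ x ^ 2 : ℝ) : ℂ)‖ ≤ C := hC x x.2
    gcongr
    exact (norm_nonneg _).trans h2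
  have h := hasSum_integral_of_summable_integral_norm
    (μ := (volume : Measure (Space d)).toSphere) (F := fun (n : ℕ)
      (x : Metric.sphere (0 : Space d) 1) => (f x * comp M n x) * ((weight Rp κ x ^ 2 : ℝ) : ℂ))
    (fun n => (hcont n).integrable_of_hasCompactSupport (HasCompactSupport.of_compactSpace _)) ?_
  · convert! h using 1
    congr 1
    ext x
    exact (((hM.hasSum_comp x).mul_left (f x)).mul_right _).tsum_eq.symm
  · refine Summable.of_norm_bounded (((Real.summable_pow_div_factorial ‖l‖).mul_left C).mul_right
      ((volume : Measure (Space d)).toSphere.real Set.univ)) fun n => ?_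
    refine norm_integral_le_of_norm_le_const (Filter.Eventually.of_forall fun x => ?_)
    rw [norm_norm]
    exact hb n x

/-! ### Polynomials -/

lemma coord_pow_mem (j : Fin d) (k : ℕ) : (fun x : Space d => (x j : ℂ) ^ k) ∈ homPoly d k := by
  induction k with
  | zero => simpa using const_mem (d := d) 1
  | succ k ih =>
    convert! linMul_mem (EuclideanSpace.single j (1 : ℝ)) ih using 1
    ext x
    rw [linMul, inner_single, pow_succ']

lemma prod_coord_pow_mem (s : Finset (Fin d)) (a : Fin d → ℕ) :
    (fun x : Space d => ∏ j ∈ s, (x j : ℂ) ^ a j) ∈ homPoly d (∑ j ∈ s, a j) := by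
  classical
  induction s using Finset.induction_on with
  | empty => simpa using const_mem (d := d) 1
  | insert j s hj ih =>
    simp only [Finset.prod_insert hj, Finset.sum_insert hj]
    exact mul_mem (coord_pow_mem j (a j)) ih

lemma sum_exponents {m : ℕ} {p : MvPolynomial (Fin d) ℂ} (hp : p.IsHomogeneous m) {a : Fin d →₀ ℕ}
    (ha : a ∈ p.support) : ∑ j, a j = m := by
  rw [← hp (MvPolynomial.mem_support_iff.1 ha), Finsupp.weight_apply]
  simp [Finsupp.sum_fintype]

lemma polyFun_mem {m : ℕ} {p : MvPolynomial (Fin d) ℂ} (hp : p.IsHomogeneous m) :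
    polyFun p ∈ homPoly d m := by
  have e : polyFun p = ∑ a ∈ p.support, p.coeff a • fun x : Space d => ∏ j, (x j : ℂ) ^ a j := by
    ext x
    simp [polyFun, MvPolynomial.eval_eq']
  rw [e]
  refine Submodule.sum_mem _ fun a ha => Submodule.smul_mem _ _ ?_
  rw [← sum_exponents hp ha]
  exact prod_coord_pow_mem _ _

lemma eval_negI {m : ℕ} {p : MvPolynomial (Fin d) ℂ} (hp : p.IsHomogeneous m) (y : Space d) :
    MvPolynomial.eval (negI y) p = (-Complex.I) ^ m * polyFun p y := by
  rw [polyFun, MvPolynomial.eval_eq', MvPolynomial.eval_eq', Finset.mul_sum]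
  refine Finset.sum_congr rfl fun a ha => ?_
  simp only [negI, mul_pow, Finset.prod_mul_distrib, Finset.prod_pow_eq_pow_sum,
    sum_exponents hp ha]
  ring

lemma sphericalTransform_eq (hd : 0 < d) (hR : IsReducedRootSystem R)
    (hRp : IsPositiveSystem R Rp) (hκ : IsMultiplicity R κ) {m : ℕ} {p : MvPolynomial (Fin d) ℂ}
    (hp : p.IsHomogeneous m) (y : Space d) :
    sphericalTransform Rp κ p y = besselSum Rp κ y (lam Rp κ) m (polyFun p) := by
  have hκ0 : ∀ α ∈ Rp, 0 ≤ κ α := fun α hα => hκ.nonneg α (hRp.mem hα)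
  have hpm := polyFun_mem hp
  obtain ⟨M, hM⟩ := exists_kernelSeries hκ0 (coordForm (negI y))
  have h1 := (hasSum_sphere_integral hM hκ0 (continuous_of_mem hpm)).mul_left (bConst Rp κ : ℂ)
  have h2 := hasSum_mean hR hRp hκ hM hpm (neg_half_le_lam hd hκ0)
  have e : ∀ n : ℕ, (bConst Rp κ : ℂ) * ∫ x : Metric.sphere (0 : Space d) 1,
      (polyFun p x * comp M n x) * ((weight Rp κ x ^ 2 : ℝ) : ℂ)
        ∂(volume : Measure (Space d)).toSphere =
      mean Rp κ (fun x => polyFun p x * comp M n x) * (besselCoeff (lam Rp κ) (m + n) : ℂ) := by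
    intro n
    rw [sphere_mean_eq hd hκ0 (mul_mem hpm (comp_mem M n)), Nat.cast_add]
  simp only [e] at h1
  rw [sphericalTransform]
  simp only [hM.dunklKernel_eq hR hRp hκ]
  exact h1.unique h2

end

end Dunkl

end

theorem proposition4p1 {d : ℕ} (hd : 0 < d)
    (R Rp : Finset (Dunkl.Space d)) (hR : Dunkl.IsReducedRootSystem R)
    (hRp : Dunkl.IsPositiveSystem R Rp)
    (κ : Dunkl.Space d → ℝ) (hκ : Dunkl.IsMultiplicity R κ)
    (m : ℕ) (p : MvPolynomial (Fin d) ℂ) (hp : p.IsHomogeneous m) :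
    (∀ y : Dunkl.Space d,
      Dunkl.sphericalTransform Rp κ p y =
        (-Complex.I) ^ m * ∑ j ∈ Finset.range (m / 2 + 1),
          (-1) ^ j / (2 ^ j * (j.factorial : ℂ)) *
            (Dunkl.besselQuot (Dunkl.lam Rp κ + (m : ℝ) - (j : ℝ)) ‖y‖ : ℂ) *
            ((Dunkl.dunklLaplacian Rp κ)^[j] (Dunkl.polyFun p)) y) ∧
    (Dunkl.IsHarmonicPoly Rp κ p →
      ∀ y : Dunkl.Space d,
        Dunkl.sphericalTransform Rp κ p y =
          (Dunkl.besselQuot (Dunkl.lam Rp κ + (m : ℝ)) ‖y‖ : ℂ) *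
            MvPolynomial.eval (Dunkl.negI y) p) := by
  have hpm := Dunkl.polyFun_mem hp
  refine ⟨fun y => ?_, fun hh y => ?_⟩
  · rw [Dunkl.sphericalTransform_eq hd hR hRp hκ hp, Dunkl.besselSum]
    congr 1
    refine (Finset.sum_subset (Finset.range_subset_range.2 (by omega)) fun j _ hj => ?_).symm
    rw [Finset.mem_range, not_lt] at hj
    rw [Dunkl.dunklLaplacian_iterate_eq_zero (by omega) hpm, Pi.zero_apply, mul_zero]
  · have hzero : Dunkl.dunklLaplacian Rp κ (Dunkl.polyFun p) = 0 := funext hh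
    rw [Dunkl.sphericalTransform_eq hd hR hRp hκ hp, Dunkl.besselSum, Finset.sum_range_succ',
      Finset.sum_eq_zero, Dunkl.eval_negI hp]
    · simp
      ring
    · intro j _
      rw [Function.iterate_succ_apply, hzero, Dunkl.dunklLaplacian_iterate_zero, Pi.zero_apply,
        mul_zero]
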